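/- Let $k$ be a field, $S=k[x_1,\dots,x_n]$ with its natural $\mathbb Z^n$-grading, and let $\mathrm{mod}_{\mathbb Z^n}S$ be the abelian category of finitely generated $\mathbb Z^n$-graded $S$-modules and degree-preserving $S$-linear maps. For an order-preserving map $q:\mathbb Z^n\to\mathbb Z^n$ and a graded module $M$, let $q^*M$ be the graded module with $(q^*M)_{\mathbf a}=M_{q(\mathbf a)}$, where $x^{\mathbf b}:(q^*M)_{\mathbf a}\to(q^*M)_{\mathbf a+\mathbf b}$ is multiplication by $x^{q(\mathbf a+\mathbf b)-q(\mathbf a)}$ on $M$; on morphisms, $(q^*f)_{\mathbf a}=f_{q(\mathbf a)}$. Fix $i\in\{1,\dots,n\}$. For $j\in\mathbb Z$ let $\sigma_{(i,j)},\lambda_{(i,j)}:\mathbb Z^n\to\mathbb Z^n$ be the order-preserving maps that change only the $i$-th coordinate, by $$\sigma_{(i,j)}(\mathbf a)_i=\begin{cases}a_i-1&\text{if }a_i\ge j,\\ a_i&\text{if }a_i<j,\end{cases}\qquad \lambda_{(i,j)}(\mathbf a)_i=\begin{cases}a_i&\text{if }a_i\ge j,\\ a_i+1&\text{if }a_i<j.\end{cases}$$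 The sliding functors $(-)^{\triangleleft(i,j)}:=\sigma_{(i,j)}^*$ and $(-)^{\triangleright(i,j)}:=\lambda_{(i,j)}^*$ are exact endofunctors of $\mathrm{mod}_{\mathbb Z^n}S$, and extend termwise to the bounded derived category $D^b(\mathrm{mod}_{\mathbb Z^n}S)$. Theorem 2.5. The functor $\mathbf R\mathrm{Hom}_S(-,S)$ on $D^b(\mathrm{mod}_{\mathbb Z^n}S)$ defines a functor $\mathbb D: D^b(\mathrm{mod}_{\mathbb Z^n}S)\to D^b(\mathrm{mod}_{\mathbb Z^n}S)^{\mathrm{op}}$, and for every $j\in\mathbb Z$ there are natural isomorphisms $$\mathbb D\circ(-)^{\triangleleft(i,j)}\cong(-)^{\triangleright(i,-j)}\circ\mathbb D\qquad\text{and}\qquad \mathbb D\circ(-)^{\triangleright(i,j)}\cong(-)^{\triangleleft(i,-j)}\circ\mathbb D .$$ In particular, for all $l\ge 0$ there are isomorphisms of $\mathbb Z^n$-graded $S$-modules, natural in $M\in\mathrm{mod}_{\mathbb Z^n}S$, $$\mathrm{Ext}^l_S(M^{\triangleleft(i,j)},S)\cong \mathrm{Ext}^l_S(M,S)^{\triangleright(i,-j)}\qquad\text{and}\qquad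 \mathrm{Ext}^l_S(M^{\triangleright(i,j)},S)\cong \mathrm{Ext}^l_S(M,S)^{\triangleleft(i,-j)} .$$ -/

import Mathlib

open CategoryTheory CategoryTheory.Limits Opposite

universe u v w

noncomputable section

namespace MultiGraded

/-- A criterion for a family of subgroups to be a direct sum decomposition. -/
theorem isInternal_of_proj {ι A : Type*} [DecidableEq ι] [AddCommGroup A]
    (G : ι → AddSubgroup A) (p : ι → A →+ A)
    (hp : ∀ a, ∀ m ∈ G a, p a m = m) (hp' : ∀ a b, a ≠ b → ∀ m ∈ G a, p b m = 0)
    (hG : ⨆ a, G a = ⊤) : DirectSum.IsInternal G := by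
  have key : ∀ b (x : DirectSum ι fun a => G a),
      p b (DirectSum.coeAddMonoidHom G x) = (x b : A) := by
    intro b x
    induction x using DirectSum.induction_on with
    | zero => simp
    | of a m =>
      by_cases h : a = b
      · subst h
        simp [hp a m m.2]
      · simp [hp' a b h m m.2, DirectSum.of_eq_of_ne _ _ _ (Ne.symm h)]
    | add x y hx hy => simp [hx, hy]
  constructor
  · rw [injective_iff_map_eq_zero]
    intro x hx
    ext b
    rw [← key, hx, map_zero]; rfl
  · intro m
    have hm : m ∈ ⨆ a, G a := hG ▸ AddSubgroup.mem_top m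
    have hle : ⨆ a, G a ≤ (DirectSum.coeAddMonoidHom G).range :=
      iSup_le fun a m hm => ⟨DirectSum.of (fun a => G a) a ⟨m, hm⟩, by simp⟩
    exact hle hm

/-- The degree in `ℤⁿ` of the monomial with exponent vector `b`. -/
def deg {n : ℕ} (b : Fin n →₀ ℕ) : Fin n → ℤ := fun i => (b i : ℤ)

theorem deg_add {n : ℕ} (b c : Fin n →₀ ℕ) : deg (b + c) = deg b + deg c := by
  funext i; simp [deg]

@[simp] theorem deg_zero {n : ℕ} : deg (0 : Fin n →₀ ℕ) = 0 := by
  funext i; simp [deg]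

theorem deg_nonneg {n : ℕ} (b : Fin n →₀ ℕ) : 0 ≤ deg b := fun i => by simp [deg]

end MultiGraded

open MultiGraded

/-- The objects of `mod_{ℤⁿ} S`, for `S = k[x₁, …, xₙ]`: finitely generated `S`-modules `M` with a
decomposition `M = ⨁ₐ Mₐ`, `a ∈ ℤⁿ`, as an abelian group such that `c x^b Mₐ ⊆ Mₐ₊ᵦ` for all
exponent vectors `b ∈ ℕⁿ` and `c ∈ k`. -/
structure GrMod (n : ℕ) (k : Type u) [Field k] : Type (u + 1) where
  carrier : Type u
  [addCommGroup : AddCommGroup carrier]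
  [module : Module (MvPolynomial (Fin n) k) carrier]
  [finite : Module.Finite (MvPolynomial (Fin n) k) carrier]
  grading : (Fin n → ℤ) → AddSubgroup carrier
  isInternal : DirectSum.IsInternal grading
  monomial_smul_mem : ∀ (b : Fin n →₀ ℕ) (c : k) (a : Fin n → ℤ) (m : carrier),
    m ∈ grading a → MvPolynomial.monomial b c • m ∈ grading (a + deg b)

namespace GrMod

variable {n : ℕ} {k : Type u} [Field k]

instance : CoeSort (GrMod n k) (Type u) := ⟨carrier⟩

attribute [instance] addCommGroup module finite

/-- The morphisms of `mod_{ℤⁿ} S`: the degree preserving `S`-linear maps. -/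
@[ext]
structure Hom (M N : GrMod n k) : Type u where
  toLin : M →ₗ[MvPolynomial (Fin n) k] N
  map_mem : ∀ (a : Fin n → ℤ) (m : M), m ∈ M.grading a → toLin m ∈ N.grading a

instance : Category (GrMod n k) where
  Hom := Hom
  id M := ⟨LinearMap.id, fun _ _ h => h⟩
  comp f g := ⟨g.toLin ∘ₗ f.toLin, fun a m h => g.map_mem a _ (f.map_mem a m h)⟩

section
variable {M N P : GrMod n k}

@[ext] theorem hom_ext {f g : M ⟶ N} (h : ∀ m : M, f.toLin m = g.toLin m) : f = g :=
  Hom.ext (LinearMap.ext h)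

@[simp] theorem id_toLin : (𝟙 M : M ⟶ M).toLin = LinearMap.id := rfl
@[simp] theorem comp_toLin (f : M ⟶ N) (g : N ⟶ P) : (f ≫ g).toLin = g.toLin ∘ₗ f.toLin := rfl

instance : Zero (M ⟶ N) := ⟨⟨0, fun a _ _ => (N.grading a).zero_mem⟩⟩
instance : Add (M ⟶ N) := ⟨fun f g => ⟨f.toLin + g.toLin, fun a m h =>
  (N.grading a).add_mem (f.map_mem a m h) (g.map_mem a m h)⟩⟩
instance : Neg (M ⟶ N) := ⟨fun f => ⟨-f.toLin, fun a m h =>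
  (N.grading a).neg_mem (f.map_mem a m h)⟩⟩
instance : Sub (M ⟶ N) := ⟨fun f g => ⟨f.toLin - g.toLin, fun a m h =>
  (N.grading a).sub_mem (f.map_mem a m h) (g.map_mem a m h)⟩⟩
instance : SMul ℕ (M ⟶ N) := ⟨fun r f => ⟨r • f.toLin, fun a m h =>
  (N.grading a).nsmul_mem (f.map_mem a m h) r⟩⟩
instance : SMul ℤ (M ⟶ N) := ⟨fun r f => ⟨r • f.toLin, fun a m h =>
  (N.grading a).zsmul_mem (f.map_mem a m h) r⟩⟩

@[simp] theorem zero_toLin : (0 : M ⟶ N).toLin = 0 := rfl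
@[simp] theorem add_toLin (f g : M ⟶ N) : (f + g).toLin = f.toLin + g.toLin := rfl

theorem toLin_injective : Function.Injective (Hom.toLin : (M ⟶ N) → _) :=
  fun _ _ h => Hom.ext h

instance : AddCommGroup (M ⟶ N) :=
  Function.Injective.addCommGroup (M₁ := (M ⟶ N)) Hom.toLin toLin_injective rfl (fun _ _ => rfl) (fun _ => rfl) (fun _ _ => rfl)
    (fun _ _ => rfl) (fun _ _ => rfl)

instance : Preadditive (GrMod n k) where
  add_comp _ _ _ _ _ _ := by ext; simp
  comp_add _ _ _ _ _ _ := by ext; simp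

end

section

variable (M : GrMod n k)

/-- The decomposition of `M` into its homogeneous components. -/
def decomp : M ≃+ DirectSum (Fin n → ℤ) (fun a => M.grading a) :=
  (AddEquiv.ofBijective (DirectSum.coeAddMonoidHom M.grading)
    (show Function.Bijective _ from M.isInternal)).symm

theorem decomp_coe (x : DirectSum (Fin n → ℤ) (fun a => M.grading a)) :
    M.decomp (DirectSum.coeAddMonoidHom M.grading x) = x :=
  (AddEquiv.ofBijective (DirectSum.coeAddMonoidHom M.grading)
    (show Function.Bijective _ from M.isInternal)).symm_apply_apply x

theorem coe_decomp (m : M) : DirectSum.coeAddMonoidHom M.grading (M.decomp m) = m :=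
  (AddEquiv.ofBijective (DirectSum.coeAddMonoidHom M.grading)
    (show Function.Bijective _ from M.isInternal)).apply_symm_apply m

theorem decomp_of_mem {a : Fin n → ℤ} {m : M} (h : m ∈ M.grading a) :
    M.decomp m = DirectSum.of (fun a => M.grading a) a ⟨m, h⟩ := by
  rw [← M.decomp_coe (DirectSum.of (fun a => M.grading a) a ⟨m, h⟩)]
  simp

/-- The projection of `M` onto its homogeneous component of degree `a`. -/
def proj (a : Fin n → ℤ) : M →+ M where
  toFun m := (M.decomp m a : M)
  map_zero' := by simp
  map_add' x y := by simp

theorem proj_apply (a : Fin n → ℤ) (m : M) : M.proj a m = (M.decomp m a : M) := rfl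

theorem proj_mem (a : Fin n → ℤ) (m : M) : M.proj a m ∈ M.grading a := (M.decomp m a).2

theorem proj_of_mem {a : Fin n → ℤ} {m : M} (h : m ∈ M.grading a) : M.proj a m = m := by
  rw [proj_apply, M.decomp_of_mem h, DirectSum.of_eq_same]

theorem proj_of_mem_ne {a b : Fin n → ℤ} (hab : a ≠ b) {m : M} (h : m ∈ M.grading a) :
    M.proj b m = 0 := by
  rw [proj_apply, M.decomp_of_mem h, DirectSum.of_eq_of_ne _ _ _ hab.symm]
  rfl

theorem iSup_grading : ⨆ a, M.grading a = ⊤ := by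
  rw [eq_top_iff]
  intro m _
  obtain ⟨x, rfl⟩ := M.isInternal.2 m
  induction x using DirectSum.induction_on with
  | zero => simp
  | of a m => simpa using AddSubgroup.mem_iSup_of_mem a m.2
  | add x y hx hy => simpa using AddSubgroup.add_mem _ (hx trivial) (hy trivial)

@[elab_as_elim]
theorem homogeneous_induction {p : M → Prop} (h0 : p 0)
    (hadd : ∀ x y, p x → p y → p (x + y)) (hom : ∀ a, ∀ m ∈ M.grading a, p m) (m : M) : p m := by
  have hm : m ∈ ⨆ a, M.grading a := M.iSup_grading ▸ AddSubgroup.mem_top m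
  induction hm using AddSubgroup.iSup_induction' with
  | hp a x hx => exact hom a x hx
  | h1 => exact h0
  | hadd x y _ _ hx hy => exact hadd x y hx hy

variable {M}

theorem map_proj {N : GrMod n k} (f : M ⟶ N) (a : Fin n → ℤ) (m : M) :
    f.toLin (M.proj a m) = N.proj a (f.toLin m) := by
  induction m using M.homogeneous_induction with
  | h0 => simp
  | hadd x y hx hy => simp [hx, hy]
  | hom b m hm =>
    by_cases h : b = a
    · subst h
      rw [M.proj_of_mem hm, N.proj_of_mem (f.map_mem _ _ hm)]
    · rw [M.proj_of_mem_ne h hm, N.proj_of_mem_ne h (f.map_mem _ _ hm), map_zero]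

theorem eq_zero_of_proj {m : M} (h : ∀ a, M.proj a m = 0) : m = 0 := by
  rw [← M.decomp.map_eq_zero_iff]
  ext a
  exact h a

theorem mem_of_proj {m : M} {a : Fin n → ℤ} (h : ∀ b, a ≠ b → M.proj b m = 0) :
    m ∈ M.grading a := by
  have : m = M.proj a m := by
    rw [← sub_eq_zero]
    refine M.eq_zero_of_proj fun b => ?_
    by_cases hb : a = b
    · subst hb
      rw [map_sub, M.proj_of_mem (M.proj_mem _ _), sub_self]
    · rw [map_sub, M.proj_of_mem_ne hb (M.proj_mem _ _), h b hb, sub_zero]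
  rw [this]
  exact M.proj_mem a m

/-- A graded submodule, as an object. -/
def ofSubmodule (M : GrMod n k) (K : Submodule (MvPolynomial (Fin n) k) M)
    (hK : ∀ a, ∀ m ∈ K, M.proj a m ∈ K) : GrMod n k where
  carrier := K
  grading a := (M.grading a).comap K.subtype.toAddMonoidHom
  isInternal := by
    let p : (Fin n → ℤ) → K →+ K := fun a =>
      { toFun := fun m => ⟨M.proj a m, hK a m m.2⟩
        map_zero' := by ext; simp
        map_add' := fun x y => by ext; simp }
    refine isInternal_of_proj _ p (fun a m hm => ?_) (fun a b hab m hm => ?_) ?_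
    · exact Subtype.ext (M.proj_of_mem hm)
    · exact Subtype.ext (M.proj_of_mem_ne hab hm)
    · rw [eq_top_iff]
      rintro ⟨m, hm⟩ -
      obtain ⟨x, rfl⟩ := M.isInternal.2 m
      have hx : ∀ a, (x a : M) ∈ K := by
        intro a
        have := hK a _ hm
        have e : M.proj a (DirectSum.coeAddMonoidHom M.grading x) = x a := by
          rw [proj_apply, M.decomp_coe]
        rwa [e] at this
      classical
      have hs : (⟨DirectSum.coeAddMonoidHom M.grading x, hm⟩ : K) =
          ∑ a ∈ DFinsupp.support x, ⟨x a, hx a⟩ := by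
        ext
        simp [DirectSum.coeAddMonoidHom_eq_dfinsuppSum, DFinsupp.sum]
      rw [hs]
      exact AddSubgroup.sum_mem _ fun a _ => AddSubgroup.mem_iSup_of_mem a (x a).2
  monomial_smul_mem b c a m hm := M.monomial_smul_mem b c a m hm

/-- A graded quotient module, as an object. -/
def ofQuotient (M : GrMod n k) (K : Submodule (MvPolynomial (Fin n) k) M)
    (hK : ∀ a, ∀ m ∈ K, M.proj a m ∈ K) : GrMod n k where
  carrier := M ⧸ K
  grading a := (M.grading a).map K.mkQ.toAddMonoidHom
  isInternal := by
    let p : (Fin n → ℤ) → (M ⧸ K) →+ (M ⧸ K) := fun a =>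
      QuotientAddGroup.map K.toAddSubgroup K.toAddSubgroup (M.proj a) (fun m hm => hK a m hm)
    have hp : ∀ a m, p a (K.mkQ m) = K.mkQ (M.proj a m) := fun a m => rfl
    refine isInternal_of_proj _ p ?_ ?_ ?_
    · rintro a _ ⟨m, hm, rfl⟩
      exact (hp a m).trans (by rw [M.proj_of_mem hm]; rfl)
    · rintro a b hab _ ⟨m, hm, rfl⟩
      exact (hp b m).trans (by rw [M.proj_of_mem_ne hab hm, map_zero])
    · rw [eq_top_iff]
      intro m _
      obtain ⟨m, rfl⟩ := K.mkQ_surjective m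
      induction m using M.homogeneous_induction with
      | h0 => simp
      | hadd x y hx hy => rw [map_add]; exact AddSubgroup.add_mem _ (hx trivial) (hy trivial)
      | hom a m hm => exact AddSubgroup.mem_iSup_of_mem a ⟨m, hm, rfl⟩
  monomial_smul_mem := by
    rintro b c a _ ⟨m, hm, rfl⟩
    exact ⟨_, M.monomial_smul_mem b c a m hm, by simp⟩

/-- The direct sum of two graded modules. -/
def prod (M N : GrMod n k) : GrMod n k where
  carrier := M × N
  grading a := (M.grading a).prod (N.grading a)
  isInternal := by
    refine isInternal_of_proj _ (fun a => (M.proj a).prodMap (N.proj a)) ?_ ?_ ?_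
    · rintro a ⟨m, m'⟩ ⟨hm, hm'⟩
      simp [M.proj_of_mem hm, N.proj_of_mem hm']
    · rintro a b hab ⟨m, m'⟩ ⟨hm, hm'⟩
      simp [M.proj_of_mem_ne hab hm, N.proj_of_mem_ne hab hm']
    · rw [eq_top_iff]
      rintro ⟨m, m'⟩ -
      have : ((m, m') : M × N) = (m, 0) + (0, m') := by simp
      rw [this]
      refine AddSubgroup.add_mem _ ?_ ?_
      · induction m using M.homogeneous_induction with
        | h0 => exact AddSubgroup.zero_mem _
        | hadd x y hx hy =>
          have : ((x + y, 0) : M × N) = (x, 0) + (y, 0) := by simp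
          rw [this]; exact AddSubgroup.add_mem _ (hx (by simp)) (hy (by simp))
        | hom a m hm => exact AddSubgroup.mem_iSup_of_mem a ⟨hm, AddSubgroup.zero_mem _⟩
      · induction m' using N.homogeneous_induction with
        | h0 => exact AddSubgroup.zero_mem _
        | hadd x y hx hy =>
          have : ((0, x + y) : M × N) = (0, x) + (0, y) := by simp
          rw [this]; exact AddSubgroup.add_mem _ (hx (by simp)) (hy (by simp))
        | hom a m hm => exact AddSubgroup.mem_iSup_of_mem a ⟨AddSubgroup.zero_mem _, hm⟩
  monomial_smul_mem b c a m hm :=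
    ⟨M.monomial_smul_mem b c a _ hm.1, N.monomial_smul_mem b c a _ hm.2⟩

/-- The zero module. -/
def zero : GrMod n k where
  carrier := PUnit
  grading _ := ⊤
  isInternal := isInternal_of_proj _ (fun _ => 0) (fun _ _ _ => rfl) (fun _ _ _ _ _ => rfl)
    (by simp)
  monomial_smul_mem _ _ _ _ _ := trivial

end

section
variable {M N : GrMod n k} (f : M ⟶ N)

/-- The kernel of a morphism. -/
def ker : GrMod n k := M.ofSubmodule (LinearMap.ker f.toLin) fun a m hm => by
  rw [LinearMap.mem_ker] at hm ⊢
  rw [map_proj, hm, map_zero]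

/-- The inclusion of the kernel. -/
def kerι : ker f ⟶ M := ⟨(LinearMap.ker f.toLin).subtype, fun _ _ h => h⟩

/-- The cokernel of a morphism. -/
def coker : GrMod n k := N.ofQuotient (LinearMap.range f.toLin) (by
  rintro a _ ⟨m, rfl⟩
  exact ⟨_, map_proj f a m⟩)

/-- The projection to the cokernel. -/
def cokerπ : N ⟶ coker f := ⟨(LinearMap.range f.toLin).mkQ, fun _ m h => ⟨m, h, rfl⟩⟩

theorem cokerπ_surjective : Function.Surjective (cokerπ f).toLin := Submodule.mkQ_surjective _

theorem kerι_injective : Function.Injective (kerι f).toLin := Subtype.val_injective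

theorem toLin_kerι (x : ker f) : f.toLin ((kerι f).toLin x) = 0 := x.2

theorem kerι_comp : kerι f ≫ f = 0 := by
  ext x
  exact x.2

theorem comp_cokerπ : f ≫ cokerπ f = 0 := by
  ext x
  exact (Submodule.Quotient.mk_eq_zero _).2 ⟨x, rfl⟩

theorem cokerπ_eq_zero {y : N} (h : (cokerπ f).toLin y = 0) : ∃ x, f.toLin x = y :=
  (Submodule.Quotient.mk_eq_zero _).1 h

theorem mem_range_of_kerι {x : M} (h : f.toLin x = 0) : ∃ y, (kerι f).toLin y = x := ⟨⟨x, h⟩, rfl⟩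

/-- Lifting along an injective morphism. -/
def liftInj (hf : Function.Injective f.toLin) {P : GrMod n k} (g : P ⟶ N)
    (hg : ∀ x, ∃ y, f.toLin y = g.toLin x) : P ⟶ M where
  toLin := (LinearEquiv.ofInjective f.toLin hf).symm.toLinearMap ∘ₗ
    g.toLin.codRestrict (LinearMap.range f.toLin) hg
  map_mem a x hx := by
    have key : ∀ x, f.toLin (((LinearEquiv.ofInjective f.toLin hf).symm.toLinearMap ∘ₗ
        g.toLin.codRestrict (LinearMap.range f.toLin) hg) x) = g.toLin x := fun x =>
      congrArg Subtype.val ((LinearEquiv.ofInjective f.toLin hf).apply_symm_apply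
        (g.toLin.codRestrict (LinearMap.range f.toLin) hg x))
    refine M.mem_of_proj fun b hb => hf ?_
    rw [map_proj, key, map_zero, N.proj_of_mem_ne hb (g.map_mem a x hx)]

theorem liftInj_comp (hf : Function.Injective f.toLin) {P : GrMod n k} (g : P ⟶ N)
    (hg : ∀ x, ∃ y, f.toLin y = g.toLin x) : liftInj f hf g hg ≫ f = g := by
  ext x
  exact congrArg Subtype.val ((LinearEquiv.ofInjective f.toLin hf).apply_symm_apply
        (g.toLin.codRestrict (LinearMap.range f.toLin) hg x))

/-- Descending along a surjective morphism. -/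
def descSurj (hf : Function.Surjective f.toLin) {P : GrMod n k} (g : M ⟶ P)
    (hg : ∀ x, f.toLin x = 0 → g.toLin x = 0) : N ⟶ P where
  toLin := (LinearMap.ker f.toLin).liftQ g.toLin hg ∘ₗ
    (f.toLin.quotKerEquivOfSurjective hf).symm.toLinearMap
  map_mem a y hy := by
    obtain ⟨x, rfl⟩ := hf y
    have : f.toLin x = f.toLin (M.proj a x) := by
      rw [map_proj, N.proj_of_mem hy]
    rw [this]
    have e : (f.toLin.quotKerEquivOfSurjective hf).symm (f.toLin (M.proj a x)) =
        (LinearMap.ker f.toLin).mkQ (M.proj a x) := by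
      rw [LinearEquiv.symm_apply_eq]; rfl
    rw [LinearMap.comp_apply, LinearEquiv.coe_coe, e]
    exact g.map_mem a _ (M.proj_mem a x)

theorem comp_descSurj (hf : Function.Surjective f.toLin) {P : GrMod n k} (g : M ⟶ P)
    (hg : ∀ x, f.toLin x = 0 → g.toLin x = 0) : f ≫ descSurj f hf g hg = g := by
  ext x
  have e : (f.toLin.quotKerEquivOfSurjective hf).symm (f.toLin x) =
        (LinearMap.ker f.toLin).mkQ x := by
      rw [LinearEquiv.symm_apply_eq]; rfl
  rw [comp_toLin, LinearMap.comp_apply, descSurj, LinearMap.comp_apply, LinearEquiv.coe_coe, e]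
  rfl

theorem mono_of_injective (hf : Function.Injective f.toLin) : Mono f where
  right_cancellation g h e := by
    ext x
    exact hf (LinearMap.congr_fun (congrArg Hom.toLin e) x)

theorem epi_of_surjective (hf : Function.Surjective f.toLin) : Epi f where
  left_cancellation g h e := by
    ext y
    obtain ⟨x, rfl⟩ := hf y
    exact LinearMap.congr_fun (congrArg Hom.toLin e) x

theorem injective_of_mono [Mono f] : Function.Injective f.toLin := by
  rw [injective_iff_map_eq_zero]
  intro x hx
  obtain ⟨y, rfl⟩ := mem_range_of_kerι f hx
  have : kerι f = 0 := by rw [← cancel_mono f, kerι_comp, zero_comp]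
  rw [this]; rfl

theorem surjective_of_epi [Epi f] : Function.Surjective f.toLin := by
  intro y
  refine cokerπ_eq_zero f ?_
  have : cokerπ f = 0 := by rw [← cancel_epi f, comp_cokerπ, comp_zero]
  rw [this]; rfl

/-- An injective morphism is the kernel of any `g` with the expected zeros. -/
def isLimitOfExact (hf : Function.Injective f.toLin) {P : GrMod n k} (g : N ⟶ P) (w : f ≫ g = 0)
    (h : ∀ y, g.toLin y = 0 → ∃ x, f.toLin x = y) : IsLimit (KernelFork.ofι f w) :=
  have := mono_of_injective f hf
  KernelFork.IsLimit.ofι' f w fun t ht =>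
    ⟨liftInj f hf t fun x => h _ (LinearMap.congr_fun (congrArg Hom.toLin ht) x),
      liftInj_comp f hf t _⟩

/-- A surjective morphism is the cokernel of any `g` with the expected range. -/
def isColimitOfExact (hf : Function.Surjective f.toLin) {P : GrMod n k} (g : P ⟶ M)
    (w : g ≫ f = 0) (h : ∀ y, f.toLin y = 0 → ∃ x, g.toLin x = y) :
    IsColimit (CokernelCofork.ofπ f w) :=
  have := epi_of_surjective f hf
  CokernelCofork.IsColimit.ofπ' f w fun t ht =>
    ⟨descSurj f hf t fun x hx => by
      obtain ⟨y, rfl⟩ := h x hx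
      exact LinearMap.congr_fun (congrArg Hom.toLin ht) y,
      comp_descSurj f hf t _⟩

end

instance : HasKernels (GrMod n k) where
  has_limit f := ⟨⟨_, isLimitOfExact (kerι f) (kerι_injective f) f (kerι_comp f)
    fun _ h => mem_range_of_kerι f h⟩⟩

instance : HasCokernels (GrMod n k) where
  has_colimit f := ⟨⟨_, isColimitOfExact (cokerπ f) (cokerπ_surjective f) f (comp_cokerπ f)
    fun _ h => cokerπ_eq_zero f h⟩⟩

theorem isZero_zero : IsZero (zero : GrMod n k) := by
  rw [IsZero.iff_id_eq_zero]
  ext x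
  rfl

instance : HasZeroObject (GrMod n k) := ⟨⟨zero, isZero_zero⟩⟩

instance : HasBinaryBiproducts (GrMod n k) := by
  refine HasBinaryBiproducts.mk fun {M N} => HasBinaryBiproduct.mk
    { bicone :=
        { pt := M.prod N
          fst := ⟨LinearMap.fst _ _ _, fun _ _ h => h.1⟩
          snd := ⟨LinearMap.snd _ _ _, fun _ _ h => h.2⟩
          inl := ⟨LinearMap.inl _ _ _, fun a _ h => ⟨h, (N.grading a).zero_mem⟩⟩
          inr := ⟨LinearMap.inr _ _ _, fun a _ h => ⟨(M.grading a).zero_mem, h⟩⟩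
          inl_fst := rfl
          inl_snd := rfl
          inr_fst := rfl
          inr_snd := rfl }
      isBilimit := isBinaryBilimitOfTotal _ ?_ }
  ext x
  exact Prod.fst_add_snd x

instance : HasFiniteProducts (GrMod n k) := hasFiniteProducts_of_has_binary_and_terminal

instance : IsNormalMonoCategory (GrMod n k) where
  normalMonoOfMono f _ := ⟨⟨_, cokerπ f, comp_cokerπ f,
    isLimitOfExact f (injective_of_mono f) _ _ fun _ h => cokerπ_eq_zero f h⟩⟩

instance : IsNormalEpiCategory (GrMod n k) where
  normalEpiOfEpi f _ := ⟨⟨_, kerι f, kerι_comp f,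
    isColimitOfExact f (surjective_of_epi f) _ _ fun _ h => mem_range_of_kerι f h⟩⟩

instance : Abelian (GrMod n k) where

theorem exact_iff (T : ShortComplex (GrMod n k)) :
    T.Exact ↔ ∀ y, T.g.toLin y = 0 → ∃ x, T.f.toLin x = y := by
  have hι : ∀ z, (kernel.ι T.g).toLin ((kernel.lift T.g T.f T.zero).toLin z) = T.f.toLin z :=
    fun z => LinearMap.congr_fun (congrArg Hom.toLin (kernel.lift_ι T.g T.f T.zero)) z
  rw [ShortComplex.exact_iff_epi_kernel_lift]
  constructor
  · intro _ y hy
    obtain ⟨x, rfl⟩ := mem_range_of_kerι T.g hy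
    obtain ⟨z, hz⟩ := surjective_of_epi (kernel.lift T.g T.f T.zero)
      ((kernel.lift T.g (kerι T.g) (kerι_comp T.g)).toLin x)
    refine ⟨z, ?_⟩
    rw [← hι, hz]
    exact LinearMap.congr_fun (congrArg Hom.toLin (kernel.lift_ι T.g _ (kerι_comp T.g))) x
  · intro h
    refine epi_of_surjective _ fun y => ?_
    obtain ⟨x, hx⟩ := h ((kernel.ι T.g).toLin y)
      (LinearMap.congr_fun (congrArg Hom.toLin (kernel.condition T.g)) y)
    refine ⟨x, injective_of_mono (kernel.ι T.g) ?_⟩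
    rw [hι, hx]

/-- The exponent vector of the monomial `x ^ (b - a)`, for `a ≤ b` in `ℤⁿ`. -/
def expo (a b : Fin n → ℤ) : Fin n →₀ ℕ :=
  Finsupp.equivFunOnFinite.symm fun i => (b i - a i).toNat

theorem add_deg_expo {a b : Fin n → ℤ} (h : a ≤ b) : a + deg (expo a b) = b := by
  funext i
  have := h i
  simp [deg, expo]
  lia

theorem expo_add {a b c : Fin n → ℤ} (h : a ≤ b) (h' : b ≤ c) :
    expo a b + expo b c = expo a c := by
  ext i
  have := h i
  have := h' i
  simp [expo]
  lia

@[simp] theorem expo_self (a : Fin n → ℤ) : expo a a = 0 := by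
  ext i; simp [expo]

@[simp] theorem expo_add_deg (a : Fin n → ℤ) (b : Fin n →₀ ℕ) : expo a (a + deg b) = b := by
  ext i; simp [expo, deg]

section pullback

variable (q : (Fin n → ℤ) → (Fin n → ℤ))

/-- The additive group `⨁ₐ M_{q(a)}`. -/
def Pull (M : GrMod n k) : Type u := DirectSum (Fin n → ℤ) fun a => M.grading (q a)

namespace Pull
variable {q}

variable {M : GrMod n k}

instance : AddCommGroup (Pull q M) :=
  inferInstanceAs (AddCommGroup (DirectSum (Fin n → ℤ) fun a => M.grading (q a)))

/-- `y ∈ M_{q(a)}` as an element of degree `a`. -/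
def of (a : Fin n → ℤ) : M.grading (q a) →+ Pull q M :=
  DirectSum.of (fun a => M.grading (q a)) a

/-- The component in `M_{q(a)}`. -/
def comp (a : Fin n → ℤ) : Pull q M →+ M.grading (q a) :=
  DFinsupp.evalAddMonoidHom (β := fun a => M.grading (q a)) a

/-- Additive maps out. -/
def lift {B : Type*} [AddCommMonoid B] (f : ∀ a, M.grading (q a) →+ B) : Pull q M →+ B :=
  DirectSum.toAddMonoid f

theorem lift_of {B : Type*} [AddCommMonoid B] (f : ∀ a, M.grading (q a) →+ B) (a : Fin n → ℤ)
    (m : M.grading (q a)) : lift f (of a m) = f a m := DirectSum.toAddMonoid_of _ _ _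

theorem comp_of_same (a : Fin n → ℤ) (m : M.grading (q a)) : comp a (of a m) = m :=
  DirectSum.of_eq_same _ _

theorem comp_of_ne {a b : Fin n → ℤ} (h : a ≠ b) (m : M.grading (q a)) : comp b (of a m) = 0 :=
  DirectSum.of_eq_of_ne _ _ _ h.symm

theorem ext_comp {x y : Pull q M} (h : ∀ a, comp a x = comp a y) : x = y := DFinsupp.ext h

@[elab_as_elim]
theorem induction {p : Pull q M → Prop} (x : Pull q M) (h0 : p 0) (hof : ∀ a m, p (of a m))
    (hadd : ∀ x y, p x → p y → p (x + y)) : p x :=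
  DirectSum.induction_on x h0 hof hadd

theorem of_congr {a b : Fin n → ℤ} (h : a = b) {x : M.grading (q a)} {y : M.grading (q b)}
    (hxy : (x : M) = y) : of a x = of b y := by
  subst h
  rw [Subtype.ext hxy]

theorem addHom_ext {B : Type*} [AddCommMonoid B] {f g : Pull q M →+ B}
    (h : ∀ a m, f (of a m) = g (of a m)) : f = g := DirectSum.addHom_ext h

/-- Multiplication by `c x^b` on `⨁ₐ M_{q(a)}`: it sends `y ∈ M_{q(a)}` to
`c x^{q(a+b)-q(a)} y ∈ M_{q(a+b)}`. -/
def act (hq : Monotone q) (b : Fin n →₀ ℕ) (c : k) : AddMonoid.End (Pull q M) :=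
  lift fun a => (of (a + deg b)).comp <|
    { toFun := fun m =>
        ⟨MvPolynomial.monomial (expo (q a) (q (a + deg b))) c • (m : M), by
          have := M.monomial_smul_mem (expo (q a) (q (a + deg b))) c _ _ m.2
          rwa [add_deg_expo (hq (le_add_of_nonneg_right (deg_nonneg b)))] at this⟩
      map_zero' := by ext; simp
      map_add' := fun x y => by ext; simp }

theorem act_of (hq : Monotone q) (b : Fin n →₀ ℕ) (c : k) (a : Fin n → ℤ) (m : M.grading (q a)) :
    ∃ h, act hq b c (of a m) =
      of (a + deg b) ⟨MvPolynomial.monomial (expo (q a) (q (a + deg b))) c • (m : M), h⟩ :=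
  ⟨_, lift_of _ _ _⟩

theorem act_of_eq (hq : Monotone q) (b : Fin n →₀ ℕ) (c : k) {a a' : Fin n → ℤ}
    (m : M.grading (q a)) (y : M.grading (q a')) (h : a' = a + deg b)
    (hy : (y : M) = MvPolynomial.monomial (expo (q a) (q a')) c • (m : M)) :
    act hq b c (of a m) = of a' y := by
  obtain ⟨_, h2⟩ := act_of hq b c a m
  rw [h2]
  refine of_congr h.symm ?_
  rw [hy, h]

theorem act_mul (hq : Monotone q) (b b' : Fin n →₀ ℕ) (c c' : k) :
    act (M := M) hq (b + b') (c * c') = act hq b c * act hq b' c' := by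
  refine addHom_ext fun a m => ?_
  obtain ⟨h1, e1⟩ := act_of hq b' c' a m
  change _ = act hq b c (act hq b' c' (of a m))
  rw [e1]
  obtain ⟨h2, e2⟩ := act_of hq b c _ ⟨_, h1⟩
  rw [e2]
  refine act_of_eq hq _ _ _ _ (by rw [deg_add]; abel) ?_
  have h := expo_add (hq (le_add_of_nonneg_right (a := a) (deg_nonneg b')))
    (hq (le_add_of_nonneg_right (a := a + deg b') (deg_nonneg b)))
  change MvPolynomial.monomial _ c • MvPolynomial.monomial _ c' • (m : M) = _
  rw [← mul_smul, MvPolynomial.monomial_mul, add_comm, h]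

theorem act_one (hq : Monotone q) : act (M := M) hq 0 1 = 1 := by
  refine addHom_ext fun a m => ?_
  exact act_of_eq hq _ _ _ _ (by simp) (by simp)

theorem act_add (hq : Monotone q) (b : Fin n →₀ ℕ) (c c' : k) :
    act (M := M) hq b (c + c') = act hq b c + act hq b c' := by
  refine addHom_ext fun a m => ?_
  obtain ⟨h1, e1⟩ := act_of hq b c a m
  obtain ⟨h2, e2⟩ := act_of hq b c' a m
  change _ = act hq b c (of a m) + act hq b c' (of a m)
  rw [e1, e2, ← map_add]
  refine act_of_eq hq _ _ _ _ rfl ?_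
  simp [add_smul]

theorem act_zero (hq : Monotone q) (b : Fin n →₀ ℕ) :
    act (M := M) hq b (0 : k) = 0 := by
  have := act_add (M := M) hq b 0 0
  simpa using this

/-- The action of `S` on `⨁ₐ M_{q(a)}`. -/
def ringHom (hq : Monotone q) : MvPolynomial (Fin n) k →+* AddMonoid.End (Pull q M) :=
  AddMonoidAlgebra.liftNCRingHom
    { toFun := act hq 0
      map_one' := act_one hq
      map_mul' := fun c c' => by rw [← act_mul, add_zero]
      map_zero' := act_zero hq 0
      map_add' := act_add hq 0 }
    { toFun := fun b => act hq b.toAdd 1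
      map_one' := act_one hq
      map_mul' := fun b b' => by rw [← act_mul, mul_one, toAdd_mul] }
    (fun c b => by
      change act hq 0 c * act hq b.toAdd 1 = act hq b.toAdd 1 * act hq 0 c
      rw [← act_mul, ← act_mul, mul_comm, add_comm])

theorem ringHom_monomial (hq : Monotone q) (b : Fin n →₀ ℕ) (c : k) :
    ringHom (M := M) hq (MvPolynomial.monomial b c) = act hq b c := by
  refine (AddMonoidAlgebra.liftNC_single _ _ _ _).trans ?_
  change act hq 0 c * act hq b 1 = _
  rw [← act_mul, zero_add, mul_one]

end Pull
end pullback

theorem exists_generators (M : GrMod n k) :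
    ∃ (r : ℕ) (a : Fin r → (Fin n → ℤ)) (m : Fin r → M), (∀ l, m l ∈ M.grading (a l)) ∧
      Submodule.span (MvPolynomial (Fin n) k) (Set.range m) = ⊤ := by
  classical
  obtain ⟨s, hs⟩ := M.finite.fg_top
  let t : Finset ((_ : M) × (Fin n → ℤ)) := s.sigma fun m => DFinsupp.support (M.decomp m)
  let e := t.equivFin.symm
  refine ⟨t.card, fun l => (e l).1.2, fun l => M.proj (e l).1.2 (e l).1.1,
    fun l => M.proj_mem _ _, ?_⟩
  rw [eq_top_iff, ← hs, Submodule.span_le]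
  intro m hm
  have : m = ∑ a ∈ DFinsupp.support (M.decomp m), M.proj a m := by
    conv_lhs => rw [← M.coe_decomp m]
    rw [DirectSum.coeAddMonoidHom_eq_dfinsuppSum, DFinsupp.sum]
    rfl
  rw [this]
  refine Submodule.sum_mem _ fun a ha => Submodule.subset_span ?_
  refine ⟨e.symm ⟨⟨m, a⟩, Finset.mem_sigma.2 ⟨hm, ha⟩⟩, ?_⟩
  simp

theorem mem_closure_of_generators {M : GrMod n k} {r : ℕ} {a : Fin r → (Fin n → ℤ)}
    {m : Fin r → M} (hm : ∀ l, m l ∈ M.grading (a l))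
    (hs : Submodule.span (MvPolynomial (Fin n) k) (Set.range m) = ⊤)
    {b : Fin n → ℤ} {y : M} (hy : y ∈ M.grading b) :
    y ∈ AddSubgroup.closure {z : M | ∃ (l : Fin r) (c : k), a l ≤ b ∧
      z = MvPolynomial.monomial (expo (a l) b) c • m l} := by
  have key : ∀ y : M, M.proj b y ∈ AddSubgroup.closure {z : M | ∃ (l : Fin r) (c : k), a l ≤ b ∧
      z = MvPolynomial.monomial (expo (a l) b) c • m l} := by
    intro y
    have hy : y ∈ Submodule.span (MvPolynomial (Fin n) k) (Set.range m) := hs ▸ Submodule.mem_top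
    obtain ⟨c, rfl⟩ := (Submodule.mem_span_range_iff_exists_fun _).1 hy
    rw [map_sum]
    refine AddSubgroup.sum_mem _ fun l _ => ?_
    induction c l using MvPolynomial.induction_on' with
    | monomial β c =>
      have h := M.monomial_smul_mem β c (a l) (m l) (hm l)
      by_cases hb : a l + deg β = b
      · subst hb
        rw [M.proj_of_mem h]
        exact AddSubgroup.subset_closure
          ⟨l, c, le_add_of_nonneg_right (deg_nonneg β), by rw [expo_add_deg]⟩
      · rw [M.proj_of_mem_ne hb h]
        exact AddSubgroup.zero_mem _
    | add x y hx hy =>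
      rw [add_smul, map_add]
      exact AddSubgroup.add_mem _ hx hy
  rw [← M.proj_of_mem hy]
  exact key y

section
variable {p q : (Fin n → ℤ) → (Fin n → ℤ)} (gc : GaloisConnection p q)

/-- The graded module `q^*M`, with `(q^*M)ₐ = M_{q(a)}` and with `x^b : (q^*M)ₐ → (q^*M)ₐ₊ᵦ`
given by multiplication with `x^{q(a+b)-q(a)}`. Here `q` is an order preserving self-map of `ℤⁿ`;
it is required to have a left adjoint `p`, so that `q^*M` is again finitely generated. -/
def pullObj (M : GrMod n k) : GrMod n k where
  carrier := Pull q M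
  module := Module.compHom _ (Pull.ringHom (M := M) gc.monotone_u)
  finite := by
    let _ : Module (MvPolynomial (Fin n) k) (Pull q M) :=
      Module.compHom _ (Pull.ringHom (M := M) gc.monotone_u)
    have smul_def : ∀ (b : Fin n →₀ ℕ) (c : k) (x : Pull q M),
        MvPolynomial.monomial b c • x = Pull.act gc.monotone_u b c x := fun b c x => by
      rw [← Pull.ringHom_monomial]; rfl
    obtain ⟨r, a, m, hm, hs⟩ := M.exists_generators
    let g : Fin r → Pull q M := fun l => Pull.of (p (a l))
      ⟨MvPolynomial.monomial (expo (a l) (q (p (a l)))) (1 : k) • m l, by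
        have := M.monomial_smul_mem (expo (a l) (q (p (a l)))) (1 : k) _ _ (hm l)
        rwa [add_deg_expo (gc.le_u_l _)] at this⟩
    refine ⟨⟨(Set.finite_range g).toFinset, ?_⟩⟩
    rw [Set.Finite.coe_toFinset, eq_top_iff]
    intro x _
    induction x using Pull.induction with
    | h0 => exact Submodule.zero_mem _
    | hadd x y hx hy => exact Submodule.add_mem _ (hx trivial) (hy trivial)
    | hof b y =>
      obtain ⟨y, hy⟩ := y
      have := mem_closure_of_generators hm hs hy
      suffices ∃ h, Pull.of b ⟨y, h⟩ ∈
          Submodule.span (MvPolynomial (Fin n) k) (Set.range g) from this.2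
      rename_i ht
      clear ht hy
      induction this using AddSubgroup.closure_induction with
      | zero => exact ⟨AddSubgroup.zero_mem _, by
          have : Pull.of (q := q) b ⟨(0 : M), AddSubgroup.zero_mem _⟩ = 0 := map_zero (Pull.of b)
          rw [this]
          exact Submodule.zero_mem _⟩
      | add x y _ _ hx hy =>
        obtain ⟨h1, e1⟩ := hx
        obtain ⟨h2, e2⟩ := hy
        refine ⟨AddSubgroup.add_mem _ h1 h2, ?_⟩
        have := (Pull.of (q := q) b).map_add ⟨x, h1⟩ ⟨y, h2⟩
        exact this ▸ Submodule.add_mem _ e1 e2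
      | neg x _ hx =>
        obtain ⟨h1, e1⟩ := hx
        refine ⟨AddSubgroup.neg_mem _ h1, ?_⟩
        have := (Pull.of (q := q) b).map_neg ⟨x, h1⟩
        exact this ▸ Submodule.neg_mem _ e1
      | mem z hz =>
        obtain ⟨l, c, hl, rfl⟩ := hz
        have hz := M.monomial_smul_mem (expo (a l) (q b)) c _ _ (hm l)
        rw [add_deg_expo hl] at hz
        refine ⟨hz, ?_⟩
        have hl' : p (a l) ≤ b := (gc _ _).2 hl
        have : Pull.of b ⟨_, hz⟩ = MvPolynomial.monomial (expo (p (a l)) b) c • g l := by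
          rw [smul_def]
          refine (Pull.act_of_eq _ _ _ _ _ (add_deg_expo hl').symm ?_).symm
          rw [← mul_smul, MvPolynomial.monomial_mul, mul_one, add_comm,
            expo_add (gc.le_u_l _) (gc.monotone_u hl')]
        rw [this]
        exact Submodule.smul_mem _ _ (Submodule.subset_span ⟨l, rfl⟩)
  grading a := (Pull.of a).range
  isInternal := by
    refine isInternal_of_proj _ (fun a => (Pull.of a).comp (Pull.comp a)) ?_ ?_ ?_
    · rintro a _ ⟨m, rfl⟩
      simp [Pull.comp_of_same]
    · rintro a b h _ ⟨m, rfl⟩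
      simp [Pull.comp_of_ne h]
    · rw [eq_top_iff]
      intro x _
      induction x using Pull.induction with
      | h0 => exact AddSubgroup.zero_mem _
      | hadd x y hx hy => exact AddSubgroup.add_mem _ (hx trivial) (hy trivial)
      | hof a m => exact AddSubgroup.mem_iSup_of_mem a ⟨m, rfl⟩
  monomial_smul_mem := by
    rintro b c a _ ⟨m, rfl⟩
    obtain ⟨h, e⟩ := Pull.act_of gc.monotone_u b c a m
    refine ⟨_, e.symm.trans ?_⟩
    rw [← Pull.ringHom_monomial]
    rfl

theorem pullObj_monomial_smul (M : GrMod n k) (b : Fin n →₀ ℕ) (c : k) (x : pullObj gc M) :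
    (MvPolynomial.monomial b c • x : pullObj gc M) = Pull.act (M := M) gc.monotone_u b c x := by
  rw [← Pull.ringHom_monomial]
  rfl

variable {M N P : GrMod n k}

/-- `f` restricted to degree `a`. -/
def Hom.restrict (f : M ⟶ N) (a : Fin n → ℤ) : M.grading a →+ N.grading a where
  toFun m := ⟨f.toLin m, f.map_mem a m m.2⟩
  map_zero' := by ext; simp
  map_add' x y := by ext; simp

/-- The additive map `⨁ₐ f_{q(a)}`. -/
def Pull.map (q : (Fin n → ℤ) → (Fin n → ℤ)) (f : M ⟶ N) : Pull q M →+ Pull q N :=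
  Pull.lift fun a => (Pull.of a).comp (Hom.restrict f (q a))

theorem Pull.map_of (f : M ⟶ N) (a : Fin n → ℤ) (m : M.grading (q a)) :
    Pull.map q f (Pull.of a m) = Pull.of a (Hom.restrict f (q a) m) := Pull.lift_of _ _ _

/-- `q^*` on morphisms: `(q^*f)ₐ = f_{q(a)}`. -/
def pullMap (f : M ⟶ N) : pullObj gc M ⟶ pullObj gc N where
  toLin :=
    { toFun := Pull.map q f
      map_add' := map_add (Pull.map q f)
      map_smul' := by
        intro s x
        let φ : pullObj gc M →+ pullObj gc N := Pull.map q f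
        change φ (s • x) = s • φ x
        induction s using MvPolynomial.induction_on' with
        | add s t hs ht => rw [add_smul, add_smul, map_add, hs, ht]
        | monomial b c =>
          rw [pullObj_monomial_smul]
          refine Eq.trans ?_ (pullObj_monomial_smul gc N b c (Pull.map q f x)).symm
          refine DFunLike.congr_fun (f := (Pull.map q f).comp (Pull.act (M := M) gc.monotone_u b c))
            (g := AddMonoidHom.comp (Pull.act (M := N) gc.monotone_u b c) (Pull.map q f)) ?_ x
          refine Pull.addHom_ext fun a m => ?_
          obtain ⟨h, e⟩ := Pull.act_of gc.monotone_u b c a m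
          change Pull.map q f (Pull.act gc.monotone_u b c (Pull.of a m)) =
            Pull.act gc.monotone_u b c (Pull.map q f (Pull.of a m))
          rw [e, Pull.map_of, Pull.map_of]
          refine (Pull.act_of_eq _ _ _ _ _ rfl ?_).symm
          exact map_smul f.toLin _ _ }
  map_mem := by
    rintro a _ ⟨m, rfl⟩
    exact ⟨_, (Pull.map_of f a m).symm⟩

theorem pullMap_apply (f : M ⟶ N) (x : pullObj gc M) :
    (pullMap gc f).toLin x = Pull.map q f x := rfl

theorem pull_hom_ext {f g : pullObj gc M ⟶ N} (h : ∀ a (m : M.grading (q a)),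
    f.toLin (Pull.of a m) = g.toLin (Pull.of a m)) : f = g := by
  ext x
  exact DFunLike.congr_fun (Pull.addHom_ext (f := f.toLin.toAddMonoidHom)
    (g := g.toLin.toAddMonoidHom) h) x

theorem pullMap_of (f : M ⟶ N) (a : Fin n → ℤ) (m : M.grading (q a)) :
    (pullMap gc f).toLin (Pull.of a m) = Pull.of (M := N) a (Hom.restrict f (q a) m) :=
  Pull.map_of f a m

/-- The functor `q^* : mod_{ℤⁿ} S ⥤ mod_{ℤⁿ} S`. -/
def pull : GrMod n k ⥤ GrMod n k where
  obj M := pullObj gc M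
  map f := pullMap gc f
  map_id M := pull_hom_ext gc fun a m => pullMap_of gc _ a m
  map_comp f g := pull_hom_ext gc fun a m => by
    rw [pullMap_of]
    refine Eq.trans ?_ (congrArg (pullMap gc g).toLin (pullMap_of gc f a m)).symm
    exact (pullMap_of gc g a (Hom.restrict f (q a) m)).symm

instance : (pull (k := k) gc).Additive where
  map_add {M N f g} := pull_hom_ext gc fun a m => by
    refine (pullMap_of gc (f + g) a m).trans ?_
    refine Eq.trans ?_ (congrArg₂ (fun x y : Pull q N => x + y) (pullMap_of gc f a m)
      (pullMap_of gc g a m)).symm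
    exact map_add (Pull.of (M := N) a) (Hom.restrict f (q a) m) (Hom.restrict g (q a) m)

theorem pull_map_exact (T : ShortComplex (GrMod n k)) (hT : T.Exact) :
    (T.map (pull gc)).Exact := by
  rw [exact_iff] at hT ⊢
  intro (y : Pull q T.X₂) hy
  have hy : Pull.map q T.g y = 0 := hy
  suffices ∃ x, Pull.map q T.f x = y from this
  have hc : ∀ a, ∃ x : T.X₁.grading (q a), Hom.restrict T.f (q a) x = Pull.comp a y := by
    intro a
    have h1 : ∀ y : Pull q T.X₂, Pull.comp a (Pull.map q T.g y) =
        Hom.restrict T.g (q a) (Pull.comp a y) := by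
      intro y
      refine DFunLike.congr_fun (f := (Pull.comp a).comp (Pull.map q T.g))
        (g := (Hom.restrict T.g (q a)).comp (Pull.comp a)) (Pull.addHom_ext fun b m => ?_) y
      rw [AddMonoidHom.comp_apply, AddMonoidHom.comp_apply, Pull.map_of]
      by_cases h : b = a
      · subst h
        rw [Pull.comp_of_same, Pull.comp_of_same]
      · rw [Pull.comp_of_ne h, Pull.comp_of_ne h, map_zero]
    have h2 := h1 y
    rw [hy, map_zero] at h2
    obtain ⟨x, hx⟩ := hT (Pull.comp a y) (congrArg Subtype.val h2).symm
    refine ⟨⟨T.X₁.proj (q a) x, T.X₁.proj_mem _ _⟩, Subtype.ext ?_⟩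
    refine (map_proj T.f (q a) x).trans ?_
    rw [hx]
    exact T.X₂.proj_of_mem (Pull.comp a y).2
  choose x hx using hc
  classical
  refine ⟨∑ a ∈ DFinsupp.support y, Pull.of a (x a), ?_⟩
  rw [map_sum]
  refine Eq.trans (Finset.sum_congr rfl fun a _ => ?_)
    (DirectSum.sum_support_of (β := fun a => T.X₂.grading (q a)) y)
  rw [Pull.map_of, hx]
  rfl

instance : (pull (k := k) gc).PreservesHomology :=
  Functor.preservesHomology_of_map_exact _ (pull_map_exact gc)

instance : PreservesFiniteLimits (pull (k := k) gc) :=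
  Functor.preservesFiniteLimits_of_preservesHomology _

instance : PreservesFiniteColimits (pull (k := k) gc) :=
  Functor.preservesFiniteColimits_of_preservesHomology _

end

theorem linear_ext {M N : GrMod n k} {f g : M →ₗ[MvPolynomial (Fin n) k] N}
    (h : ∀ b, ∀ m ∈ M.grading b, f m = g m) : f = g := by
  ext m
  induction m using M.homogeneous_induction with
  | h0 => simp
  | hadd x y hx hy => rw [map_add, map_add, hx, hy]
  | hom b m hm => exact h b m hm

theorem proj_add_deg_monomial_smul (M : GrMod n k) (b : Fin n →₀ ℕ) (c : k) (a : Fin n → ℤ)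
    (m : M) : M.proj (a + deg b) (MvPolynomial.monomial b c • m) =
      MvPolynomial.monomial b c • M.proj a m := by
  induction m using M.homogeneous_induction with
  | h0 => simp
  | hadd x y hx hy => rw [smul_add, map_add, map_add, smul_add, hx, hy]
  | hom e m hm =>
    have h := M.monomial_smul_mem b c e m hm
    by_cases hea : e = a
    · subst hea
      rw [M.proj_of_mem hm, M.proj_of_mem h]
    · rw [M.proj_of_mem_ne hea hm, M.proj_of_mem_ne (fun h => hea (add_right_cancel h)) h,
        smul_zero]

section hom
variable (M N : GrMod n k)

/-- The `S`-linear maps `M → N` that are homogeneous of degree `a`. -/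
def homGrading (a : Fin n → ℤ) : AddSubgroup (M →ₗ[MvPolynomial (Fin n) k] N) where
  carrier := {f | ∀ b, ∀ m ∈ M.grading b, f m ∈ N.grading (a + b)}
  add_mem' hf hg b m hm := AddSubgroup.add_mem _ (hf b m hm) (hg b m hm)
  zero_mem' b _ _ := (N.grading (a + b)).zero_mem
  neg_mem' hf b m hm := AddSubgroup.neg_mem _ (hf b m hm)

variable {M N}

/-- The homogeneous component of degree `a` of a linear map, as an additive map. -/
def homProjAux (a : Fin n → ℤ) (f : M →ₗ[MvPolynomial (Fin n) k] N) : M →+ N :=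
  (DirectSum.toAddMonoid fun b => ((N.proj (a + b)).comp f.toAddMonoidHom).comp
    (M.grading b).subtype).comp M.decomp.toAddMonoidHom

theorem homProjAux_apply (a : Fin n → ℤ) (f : M →ₗ[MvPolynomial (Fin n) k] N) {b : Fin n → ℤ}
    {m : M} (hm : m ∈ M.grading b) : homProjAux a f m = N.proj (a + b) (f m) := by
  change DirectSum.toAddMonoid _ (M.decomp m) = _
  rw [M.decomp_of_mem hm, DirectSum.toAddMonoid_of]
  rfl

/-- The homogeneous component of degree `a` of a linear map. -/
def homProj (a : Fin n → ℤ) (f : M →ₗ[MvPolynomial (Fin n) k] N) :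
    M →ₗ[MvPolynomial (Fin n) k] N where
  toFun := homProjAux a f
  map_add' := map_add _
  map_smul' s m := by
    rw [RingHom.id_apply]
    induction s using MvPolynomial.induction_on' with
    | add s t hs ht => rw [add_smul, map_add, hs, ht, add_smul]
    | monomial b c =>
      induction m using M.homogeneous_induction with
      | h0 => simp
      | hadd x y hx hy => rw [smul_add, map_add, map_add, smul_add, hx, hy]
      | hom e m hm =>
        rw [homProjAux_apply a f hm, homProjAux_apply a f (M.monomial_smul_mem b c e m hm),
          map_smul, ← add_assoc, proj_add_deg_monomial_smul]

theorem homProj_apply (a : Fin n → ℤ) (f : M →ₗ[MvPolynomial (Fin n) k] N) {b : Fin n → ℤ}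
    {m : M} (hm : m ∈ M.grading b) : homProj a f m = N.proj (a + b) (f m) :=
  homProjAux_apply a f hm

variable (M N)

/-- `Hom_S(M, N)`, the module of all `S`-linear maps, with its natural grading. -/
def homObj : GrMod n k where
  carrier := M →ₗ[MvPolynomial (Fin n) k] N
  grading := homGrading M N
  isInternal := by
    classical
    refine isInternal_of_proj _ (fun a =>
      { toFun := homProj a
        map_zero' := linear_ext fun b m hm => by
          rw [homProj_apply a _ hm, LinearMap.zero_apply, map_zero]
        map_add' := fun f g => linear_ext fun b m hm => by
          rw [LinearMap.add_apply, homProj_apply a _ hm, homProj_apply a _ hm,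
            homProj_apply a _ hm, LinearMap.add_apply, map_add] }) ?_ ?_ ?_
    · intro a f hf
      refine linear_ext fun b m hm => ?_
      exact (homProj_apply a _ hm).trans (N.proj_of_mem (hf b m hm))
    · intro a a' ha f hf
      refine linear_ext fun b m hm => ?_
      exact (homProj_apply a' _ hm).trans
        (N.proj_of_mem_ne (fun h => ha (add_right_cancel h)) (hf b m hm))
    · rw [eq_top_iff]
      intro f _
      obtain ⟨r, b, m, hm, hs⟩ := M.exists_generators
      let A : Finset (Fin n → ℤ) := Finset.univ.biUnion fun l =>
        (DFinsupp.support (N.decomp (f (m l)))).image fun e => e - b l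
      have hf : f = ∑ a ∈ A, homProj a f := by
        refine LinearMap.ext_on_range hs fun l => ?_
        rw [LinearMap.sum_apply, Finset.sum_congr rfl fun a _ => homProj_apply a f (hm l)]
        have h1 : f (m l) = ∑ e ∈ DFinsupp.support (N.decomp (f (m l))), N.proj e (f (m l)) := by
          conv_lhs => rw [← N.coe_decomp (f (m l))]
          rw [DirectSum.coeAddMonoidHom_eq_dfinsuppSum, DFinsupp.sum]
          rfl
        have h2 : ∑ a ∈ A, N.proj (a + b l) (f (m l)) =
            ∑ e ∈ A.image fun a => a + b l, N.proj e (f (m l)) := by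
          rw [Finset.sum_image fun x _ y _ h => add_right_cancel h]
        rw [h2]
        refine h1.trans (Finset.sum_subset ?_ ?_)
        · intro e he
          refine Finset.mem_image.2 ⟨e - b l, ?_, sub_add_cancel _ _⟩
          exact Finset.mem_biUnion.2 ⟨l, Finset.mem_univ _, Finset.mem_image_of_mem _ he⟩
        · intro e _ he
          rw [DFinsupp.notMem_support_iff] at he
          rw [proj_apply, he]
          rfl
      rw [hf]
      refine AddSubgroup.sum_mem _ fun a _ => AddSubgroup.mem_iSup_of_mem a ?_
      intro e x hx
      rw [homProj_apply a f hx]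
      exact N.proj_mem _ _
  monomial_smul_mem b c a f hf e m hm := by
    rw [LinearMap.smul_apply, add_right_comm]
    exact N.monomial_smul_mem b c _ _ (hf e m hm)

/-- The contravariant functor `Hom_S(-, N)`. -/
def homFunctor : (GrMod n k)ᵒᵖ ⥤ GrMod n k where
  obj M := homObj M.unop N
  map f :=
    { toLin := LinearMap.lcomp _ _ f.unop.toLin
      map_mem := fun _ _ hg b m hm => hg b _ (f.unop.map_mem b m hm) }
  map_id _ := rfl
  map_comp _ _ := rfl

instance : (homFunctor N).Additive where
  map_add {M _ _ _} := by
    ext (x : M.unop →ₗ[MvPolynomial (Fin n) k] N)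
    exact LinearMap.ext fun m => map_add x _ _

end hom

/-- The polynomial ring `S` as a graded module over itself: `f` is homogeneous of degree `a` if
all its monomials have degree `a`. -/
def ring (n : ℕ) (k : Type u) [Field k] : GrMod n k where
  carrier := MvPolynomial (Fin n) k
  grading a :=
    { carrier := {f | ∀ b ∈ f.support, deg b = a}
      zero_mem' := by simp
      add_mem' := by
        intro f g hf hg b hb
        classical
        rcases Finset.mem_union.1 (MvPolynomial.support_add hb) with h | h
        · exact hf b h
        · exact hg b h
      neg_mem' := by
        intro f hf b hb
        rw [MvPolynomial.support_neg] at hb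
        exact hf b hb }
  isInternal := by
    classical
    have hw : ∀ b : Fin n →₀ ℕ, Finsupp.weight (fun i => (Pi.single i 1 : Fin n → ℤ)) b = deg b := by
      intro b
      funext i
      simp [Finsupp.weight_apply, Finsupp.sum_fintype, deg, Finset.sum_apply, Pi.single_apply]
    refine isInternal_of_proj _ (fun a => (MvPolynomial.weightedHomogeneousComponent
      (fun i => (Pi.single i 1 : Fin n → ℤ)) a).toAddMonoidHom) ?_ ?_ ?_
    · intro a f hf
      ext b
      refine (MvPolynomial.coeff_weightedHomogeneousComponent _ _ _).trans ?_
      rw [hw]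
      split_ifs with h
      · rfl
      · by_contra h0
        exact h (hf b (MvPolynomial.mem_support_iff.2 (Ne.symm h0)))
    · intro a a' h f hf
      ext b
      refine (MvPolynomial.coeff_weightedHomogeneousComponent _ _ _).trans ?_
      rw [hw, MvPolynomial.coeff_zero]
      split_ifs with hb
      · by_contra h0
        exact h ((hf b (MvPolynomial.mem_support_iff.2 h0)).symm.trans hb)
      · rfl
    · rw [eq_top_iff]
      intro f _
      induction f using MvPolynomial.induction_on' with
      | add f g hf hg => exact AddSubgroup.add_mem _ (hf trivial) (hg trivial)
      | monomial b c =>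
        refine AddSubgroup.mem_iSup_of_mem (deg b) fun b' hb' => ?_
        rw [Finset.mem_singleton.1 (MvPolynomial.support_monomial_subset hb')]
  monomial_smul_mem b c a f hf e he := by
    classical
    rw [smul_eq_mul, MvPolynomial.mem_support_iff, MvPolynomial.coeff_monomial_mul'] at he
    split_ifs at he with h
    · have := hf (e - b) (MvPolynomial.mem_support_iff.2 (right_ne_zero_of_mul he))
      rw [← this, ← deg_add, tsub_add_cancel_of_le h]
    · exact absurd rfl he

/-- The shifted module `M(a)`, with `M(a)_b = M_{a+b}`. -/
def shift (M : GrMod n k) (a : Fin n → ℤ) : GrMod n k where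
  carrier := M
  grading b := M.grading (a + b)
  isInternal := by
    refine isInternal_of_proj _ (fun b => M.proj (a + b)) (fun b m hm => M.proj_of_mem hm)
      (fun b c h m hm => M.proj_of_mem_ne (fun h' => h (add_left_cancel h')) hm) ?_
    rw [eq_top_iff, ← M.iSup_grading]
    refine iSup_le fun b => ?_
    have : M.grading b = M.grading (a + (b - a)) := by rw [add_sub_cancel]
    rw [this]
    exact le_iSup (fun b => M.grading (a + b)) (b - a)
  monomial_smul_mem b c e m hm := by
    rw [← add_assoc]
    exact M.monomial_smul_mem b c _ m hm

/-- The morphism `S(-a) → M` sending `1` to `m ∈ M_a`. -/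
def ofElement {M : GrMod n k} {a : Fin n → ℤ} {m : M} (hm : m ∈ M.grading a) :
    (ring n k).shift (-a) ⟶ M where
  toLin := LinearMap.toSpanSingleton (MvPolynomial (Fin n) k) M m
  map_mem b f hf := by
    have hf : ∀ e ∈ f.support, deg e = -a + b := hf
    change (show MvPolynomial (Fin n) k from f) • m ∈ M.grading b
    rw [MvPolynomial.as_sum f, Finset.sum_smul]
    refine AddSubgroup.sum_mem _ fun e he => ?_
    have := M.monomial_smul_mem e (f.coeff e) a m hm
    rwa [hf e he, add_neg_cancel_left] at this

theorem ofElement_one {M : GrMod n k} {a : Fin n → ℤ} {m : M} (hm : m ∈ M.grading a) :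
    (ofElement hm).toLin (1 : MvPolynomial (Fin n) k) = m :=
  one_smul (MvPolynomial (Fin n) k) m

theorem one_mem (a : Fin n → ℤ) :
    (1 : MvPolynomial (Fin n) k) ∈ ((ring n k).shift (-a)).grading a := by
  intro b hb
  have := Finset.mem_singleton.1 (MvPolynomial.support_monomial_subset hb)
  rw [this, deg_zero, neg_add_cancel]

theorem shift_hom_ext {M : GrMod n k} {a : Fin n → ℤ} {f g : (ring n k).shift (-a) ⟶ M}
    (h : f.toLin (1 : MvPolynomial (Fin n) k) = g.toLin (1 : MvPolynomial (Fin n) k)) : f = g :=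
  Hom.ext (LinearMap.ext_ring (R := MvPolynomial (Fin n) k) h)

instance projective_shift (a : Fin n → ℤ) : Projective ((ring n k).shift (-a)) where
  factors {E X} f e _ := by
    obtain ⟨y, hy⟩ := surjective_of_epi e (f.toLin (1 : MvPolynomial (Fin n) k))
    refine ⟨ofElement (E.proj_mem a y), shift_hom_ext ?_⟩
    change e.toLin ((ofElement (E.proj_mem a y)).toLin (1 : MvPolynomial (Fin n) k)) = _
    rw [ofElement_one, map_proj, hy]
    exact X.proj_of_mem (f.map_mem a _ (one_mem a))

instance : EnoughProjectives (GrMod n k) where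
  presentation M := by
    obtain ⟨r, a, m, hm, hs⟩ := M.exists_generators
    let π : (∐ fun l : ULift.{u} (Fin r) => (ring n k).shift (-(a l.down))) ⟶ M :=
      Sigma.desc fun l => ofElement (hm l.down)
    have hπ : Epi π := by
      refine Preadditive.epi_of_cancel_zero _ fun {P} g hg => ?_
      refine Hom.ext (LinearMap.ext_on_range hs fun l => ?_)
      have h1 : ofElement (hm l) ≫ g = 0 := by
        have : ofElement (hm l) =
            Sigma.ι (fun l : ULift.{u} (Fin r) => (ring n k).shift (-(a l.down))) ⟨l⟩ ≫ π := by
          simp [π]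
        rw [this, Category.assoc, hg, comp_zero]
      have h2 := LinearMap.congr_fun (congrArg Hom.toLin h1) (1 : MvPolynomial (Fin n) k)
      change g.toLin ((ofElement (hm l)).toLin (1 : MvPolynomial (Fin n) k)) = 0 at h2
      rwa [ofElement_one] at h2
    exact ⟨{ p := _, f := π }⟩

end GrMod

namespace MultiGraded

section

variable {n : ℕ} (i : Fin n) (j : ℤ)

/-- The map `σ`: subtract `1` from the `i`-th coordinate if it is `≥ j`. -/
def sigma (a : Fin n → ℤ) : Fin n → ℤ :=
  Function.update a i (if j ≤ a i then a i - 1 else a i)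

/-- The map `τ`: add `1` to the `i`-th coordinate if it is `≥ j`. -/
def tau (a : Fin n → ℤ) : Fin n → ℤ :=
  Function.update a i (if j ≤ a i then a i + 1 else a i)

/-- The map `λ`: add `1` to the `i`-th coordinate if it is `< j`. -/
def lam (a : Fin n → ℤ) : Fin n → ℤ :=
  Function.update a i (if j ≤ a i then a i else a i + 1)

/-- The map `ρ`: subtract `1` from the `i`-th coordinate if it is `≤ j`. -/
def rho (a : Fin n → ℤ) : Fin n → ℤ :=
  Function.update a i (if j < a i then a i else a i - 1)

theorem gc_tau_sigma : GaloisConnection (tau i j) (sigma i j) := by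
  intro a b
  simp only [tau, sigma, update_le_iff, le_update_iff]
  refine and_congr ?_ Iff.rfl
  split_ifs <;> lia

theorem gc_rho_lam : GaloisConnection (rho i j) (lam i j) := by
  intro a b
  simp only [rho, lam, update_le_iff, le_update_iff]
  refine and_congr ?_ Iff.rfl
  split_ifs <;> lia

end

section derived

variable {C : Type u} [Category.{v} C] [Abelian C]

theorem quasiIso_opEquivalence_map {K L : CochainComplex C ℤ} (f : K ⟶ L) [QuasiIso f] :
    QuasiIso ((CochainComplex.opEquivalence C).functor.map f.op) := by
  refine ⟨fun m => ?_⟩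
  rw [quasiIsoAt_iff' _ (m - 1) m (m + 1) (by simp) (by simp)]
  have h : QuasiIsoAt f (-m) := inferInstance
  rw [quasiIsoAt_iff' _ (-(m + 1)) (-m) (-(m - 1)) (by simp; ring) (by simp; ring)] at h
  rw [← ShortComplex.quasiIso_opMap_iff] at h
  exact h

variable [HasDerivedCategory.{w} C]

open DerivedCategory DerivedCategory.TStructure

/-- The extension `D^b(C) ⥤ D^b(C)` of an exact functor `F : C ⥤ C`: it applies `F` termwise to
complexes. -/
def mapBounded (F : C ⥤ C) [F.Additive] [PreservesFiniteLimits F] [PreservesFiniteColimits F] :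
    Bounded C ⥤ Bounded C :=
  t.bounded.lift (Bounded.ι ⋙ F.mapDerivedCategory) <| by
    rintro ⟨X, ⟨a, K, e, hK⟩, ⟨b, L, e', hL⟩⟩
    exact ⟨⟨a, (F.mapHomologicalComplex _).obj K,
        F.mapDerivedCategory.mapIso e ≪≫ F.mapDerivedCategoryFactors.app K, inferInstance⟩,
      ⟨b, (F.mapHomologicalComplex _).obj L,
        F.mapDerivedCategory.mapIso e' ≪≫ F.mapDerivedCategoryFactors.app L, inferInstance⟩⟩

variable (C) in
/-- The inclusion `D^b(C) ⥤ D^+(C)`. -/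
def boundedToPlus : Bounded C ⥤ Plus C :=
  t.plus.lift Bounded.ι fun X => X.property.1

variable [HasDerivedCategory.{w} Cᵒᵖ]

variable (C) in
/-- The canonical functor `D(C)ᵒᵖ ⥤ D(Cᵒᵖ)` sending a cochain complex `K` in `C` to the cochain
complex in `Cᵒᵖ` whose term of degree `p` is `K^{-p}`. -/
def opToDerivedOp : (DerivedCategory C)ᵒᵖ ⥤ DerivedCategory Cᵒᵖ :=
  Localization.lift ((CochainComplex.opEquivalence C).functor ⋙ Q)
    (W := (HomologicalComplex.quasiIso C (.up ℤ)).op)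
    (fun K L f hf => by
      have : QuasiIso f.unop := hf
      have := quasiIso_opEquivalence_map f.unop
      change IsIso (Q.map ((CochainComplex.opEquivalence C).functor.map f.unop.op))
      infer_instance) Q.op

variable (C) in
/-- The compatibility of `opToDerivedOp` with the localization functors. -/
def opToDerivedOpFac : Q.op ⋙ opToDerivedOp C ≅ (CochainComplex.opEquivalence C).functor ⋙ Q :=
  Localization.fac _ _ _

variable (C) in
/-- The canonical functor `D^b(C)ᵒᵖ ⥤ D^+(Cᵒᵖ)`. -/
def boundedOpToPlus : (Bounded C)ᵒᵖ ⥤ Plus Cᵒᵖ :=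
  t.plus.lift (Bounded.ι.op ⋙ opToDerivedOp C) <| by
    rintro ⟨X, -, ⟨b, K, e, hK⟩⟩
    refine ⟨-b, (CochainComplex.opEquivalence C).functor.obj (op K),
      (opToDerivedOp C).mapIso e.symm.op ≪≫ (opToDerivedOpFac C).app (op K), ?_⟩
    rw [CochainComplex.isStrictlyGE_iff]
    intro m hm
    exact (K.isZero_of_isStrictlyLE b (-m) (by lia)).op

/-- The right derived functor `RF : D^b(C)ᵒᵖ ⥤ D^+(C)` of an additive contravariant functor
`F : Cᵒᵖ ⥤ C`, when `C` has enough projectives (so `Cᵒᵖ` has enough injectives). -/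
def rightDerivedContra [EnoughProjectives C] (F : Cᵒᵖ ⥤ C) [F.Additive] :
    (Bounded C)ᵒᵖ ⥤ Plus C :=
  boundedOpToPlus C ⋙ F.rightDerivedFunctorPlus

end derived

end MultiGraded

namespace GrMod
open MultiGraded
variable {n : ℕ} {k : Type u} [Field k]

instance : HasDerivedCategory (GrMod n k) := HasDerivedCategory.standard _

instance : HasDerivedCategory (GrMod n k)ᵒᵖ := HasDerivedCategory.standard _

/-- The sliding functor `(-)^{◁(i,j)} = σ^*`. -/
abbrev slideLeft (k : Type u) [Field k] (i : Fin n) (j : ℤ) : GrMod n k ⥤ GrMod n k := pull (gc_tau_sigma i j)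
/-- The sliding functor `(-)^{▷(i,j)} = λ^*`. -/
abbrev slideRight (k : Type u) [Field k] (i : Fin n) (j : ℤ) : GrMod n k ⥤ GrMod n k := pull (gc_rho_lam i j)

/-- The functor `RHom_S(-, S) : D^b(mod_{ℤⁿ} S)ᵒᵖ ⥤ D^+(mod_{ℤⁿ} S)`. -/
def RHomRing (n : ℕ) (k : Type u) [Field k] : (DerivedCategory.Bounded (GrMod n k))ᵒᵖ ⥤ DerivedCategory.Plus (GrMod n k) :=
  rightDerivedContra (homFunctor (ring n k))

/-- The functor `Ext^l_S(-, S)`, the `l`-th right derived functor of `Hom_S(-, S)`, with values in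
`ℤⁿ`-graded modules. -/
def extRing (n : ℕ) (k : Type u) [Field k] (l : ℕ) : (GrMod n k)ᵒᵖ ⥤ GrMod n k := (homFunctor (ring n k)).rightDerived l

end GrMod

end

/-!
The proof rests on a duality for the functor `Hom_S(-, S)` on graded modules, before any derived
functor is taken.

A linear map `f : M → S` of degree `b` sends `m ∈ Mₐ` to a multiple `φ(m) x^(b+a)`, so `f` is the
same as the functional `φ : M → k`, which satisfies `φ(c x^e m) = c φ(m)` and vanishes on `Mₐ`
unless `0 ≤ b + a` (`ofFunctional`, `hom_ring_ext`). Such a `φ` on `M` restricts to the pieces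
`M_{q(a)}`, hence to `q^*M`; conversely, if `p` is left adjoint to `q`, a functional on `q^*M`
extends to `m ∈ Mₐ` by means of `x^(q(p(a))-a) m`, which lies in `M_{q(p(a))} = (q^*M)_{p(a)}`. These
two constructions identify `q'^*Hom_S(M, S)` with `Hom_S(q^*M, S)` as soon as the conditions on the
degrees match, that is, `0 ≤ q'(b) + a ↔ 0 ≤ b + p(a)` (`dualPullIso`). For
`(q, q') = (σ_(i,j), λ_(i,-j))` and `(q, q') = (λ_(i,j), σ_(i,-j))` they do, by `lam_dual_tau` and
`sigma_dual_rho`.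

The pullback `q^*` is exact, and it preserves projectives because `q^*(S(-a)) ≅ S(-p(a))`
(`shiftIso`). So an isomorphism `Hom_S(q^*-, S) ≅ q'^*Hom_S(-, S)` passes to the derived functors:
for `Ext` by applying `q^*` to projective resolutions (`rightDerivedIso`), and for the total derived
functor because both sides are right derived functors of isomorphic functors on the homotopy
category (`rightDerivedPlusIso`). All of this is phrased with injectives in the opposite category,
and `boundedOpToPlusMap` compares the two descriptions of `q^*` on the derived category.

Finally, `RHom_S(-, S)` preserves boundedness because every graded module has projective dimension
at most `n` (`hasProjectiveDimensionLT`). The modules `(S/(x_i : i ∈ T))(-a)` have projective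
dimension at most `|T|` by the Koszul exact sequences, every nonzero module contains one of them,
and Noetherian induction does the rest. A bounded complex therefore has a bounded resolution
(`exists_injective_isStrictlyLE`).
-/

noncomputable section

namespace GrMod
open MultiGraded
variable {n : ℕ} {k : Type u} [Field k]

/-! ### Graded modules -/

theorem isIso_of_bijective {M N : GrMod n k} (f : M ⟶ N) (hi : Function.Injective f.toLin)
    (hs : Function.Surjective f.toLin) : IsIso f :=
  have := mono_of_injective f hi
  have := epi_of_surjective f hs
  isIso_of_mono_of_epi f

theorem injective_of_homogeneous {M N : GrMod n k} (f : M ⟶ N)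
    (h : ∀ a, ∀ m ∈ M.grading a, f.toLin m = 0 → m = 0) : Function.Injective f.toLin := by
  rw [injective_iff_map_eq_zero]
  intro m hm
  refine M.eq_zero_of_proj fun a => h a _ (M.proj_mem a m) ?_
  rw [map_proj, hm, map_zero]

theorem surjective_of_homogeneous {M N : GrMod n k} (f : M ⟶ N)
    (h : ∀ a, ∀ y ∈ N.grading a, ∃ m, f.toLin m = y) : Function.Surjective f.toLin := by
  intro y
  induction y using N.homogeneous_induction with
  | h0 => exact ⟨0, map_zero _⟩
  | hadd x y hx hy =>
    obtain ⟨x, rfl⟩ := hx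
    obtain ⟨y, rfl⟩ := hy
    exact ⟨x + y, map_add _ _ _⟩
  | hom a y hy => exact h a y hy

/-- An additive map that commutes with the action of all terms `c x^b` is `S`-linear. -/
def linOfMonomial {M N : Type*} [AddCommGroup M] [AddCommGroup N]
    [Module (MvPolynomial (Fin n) k) M] [Module (MvPolynomial (Fin n) k) N] (f : M →+ N)
    (h : ∀ (b : Fin n →₀ ℕ) (c : k) m,
      f (MvPolynomial.monomial b c • m) = MvPolynomial.monomial b c • f m) :
    M →ₗ[MvPolynomial (Fin n) k] N where
  toFun := f
  map_add' := map_add f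
  map_smul' s m := by
    induction s using MvPolynomial.induction_on' with
    | add s t hs ht =>
      rw [RingHom.id_apply] at hs ht ⊢
      rw [add_smul, map_add, hs, ht, add_smul]
    | monomial b c => exact h b c m

/-! ### Homogeneous maps to the polynomial ring as functionals -/

/-- The sum of the coefficients of a polynomial. It is injective on each graded piece of `S`. -/
def coeffSum (n : ℕ) (k : Type u) [Field k] : ring n k →+ k :=
  (MvPolynomial.eval fun _ : Fin n => (1 : k)).toAddMonoidHom

/-- The term `c x^b`, as an element of the graded module `S`. -/
def term (b : Fin n →₀ ℕ) : k →+ ring n k :=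
  (MvPolynomial.monomial b).toAddMonoidHom

theorem coeffSum_term (b : Fin n →₀ ℕ) (c : k) : coeffSum n k (term b c) = c :=
  (MvPolynomial.eval_monomial (f := fun _ => (1 : k))).trans (by simp)

theorem monomial_smul_term (b e : Fin n →₀ ℕ) (c d : k) :
    MvPolynomial.monomial b c • term e d = term (b + e) (c * d) :=
  MvPolynomial.monomial_mul

theorem coeffSum_monomial_smul (b : Fin n →₀ ℕ) (c : k) (f : ring n k) :
    coeffSum n k (MvPolynomial.monomial b c • f) = c * coeffSum n k f :=
  (map_mul (MvPolynomial.eval fun _ : Fin n => (1 : k)) _ _).trans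
    (congrArg (· * coeffSum n k f) (coeffSum_term b c))

theorem deg_injective : Function.Injective (deg : (Fin n →₀ ℕ) → _) := by
  intro b c h
  ext i
  simpa [deg] using congrFun h i

theorem expo_zero_deg (b : Fin n →₀ ℕ) : expo 0 (deg b) = b := by
  have := expo_add_deg 0 b
  rwa [zero_add] at this

theorem term_mem (b : Fin n →₀ ℕ) (c : k) : term b c ∈ (ring n k).grading (deg b) :=
  fun b' hb' => by rw [Finset.mem_singleton.1 (MvPolynomial.support_monomial_subset hb')]

theorem eq_term_of_mem {a : Fin n → ℤ} {f : ring n k} (hf : f ∈ (ring n k).grading a)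
    (h0 : f ≠ 0) : 0 ≤ a ∧ f = term (expo 0 a) (coeffSum n k f) := by
  let F : MvPolynomial (Fin n) k := f
  have hf : ∀ e ∈ F.support, deg e = a := hf
  obtain ⟨e, he⟩ := MvPolynomial.support_nonempty.2 (show F ≠ 0 from h0)
  have ha := hf e he
  subst ha
  have h1 : F = MvPolynomial.monomial e (F.coeff e) := by
    conv_lhs => rw [MvPolynomial.as_sum F]
    exact Finset.sum_eq_single e (fun b hb hbe => absurd (deg_injective (hf b hb)) hbe)
      (fun h => absurd he h)
  have h2 : f = term e (F.coeff e) := h1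
  refine ⟨deg_nonneg e, ?_⟩
  rw [expo_zero_deg, h2, coeffSum_term]

theorem eq_of_coeffSum {a : Fin n → ℤ} {f g : ring n k} (hf : f ∈ (ring n k).grading a)
    (hg : g ∈ (ring n k).grading a) (h : coeffSum n k f = coeffSum n k g) : f = g := by
  by_contra hne
  have h1 := (eq_term_of_mem (AddSubgroup.sub_mem _ hf hg) (sub_ne_zero.2 hne)).2
  rw [map_sub, sub_eq_zero.2 h, map_zero] at h1
  exact hne (sub_eq_zero.1 h1)

/-- A degree `b` map to `S` is determined by the sums of coefficients of its values. -/
theorem hom_ring_ext {M : GrMod n k} {b : Fin n → ℤ}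
    {f g : M →ₗ[MvPolynomial (Fin n) k] ring n k}
    (hf : f ∈ homGrading M (ring n k) b) (hg : g ∈ homGrading M (ring n k) b)
    (h : ∀ a, ∀ m ∈ M.grading a, coeffSum n k (f m) = coeffSum n k (g m)) : f = g :=
  linear_ext fun a m hm => eq_of_coeffSum (hf a m hm) (hg a m hm) (h a m hm)

section
variable {M : GrMod n k} (b : Fin n → ℤ) (φ : M →+ k)

/-- The additive map `M → S` that sends `m ∈ Mₐ` to `φ(m) x^(b+a)`. -/
def ofFunctionalAux : M →+ ring n k :=
  (DirectSum.toAddMonoid fun a => (term (expo 0 (b + a))).comp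
    (φ.comp (M.grading a).subtype)).comp M.decomp.toAddMonoidHom

theorem ofFunctionalAux_apply {a : Fin n → ℤ} {m : M} (hm : m ∈ M.grading a) :
    ofFunctionalAux b φ m = term (expo 0 (b + a)) (φ m) := by
  change DirectSum.toAddMonoid _ (M.decomp m) = _
  rw [M.decomp_of_mem hm, DirectSum.toAddMonoid_of]
  rfl

variable (h1 : ∀ (e : Fin n →₀ ℕ) (c : k) a, ∀ m ∈ M.grading a,
    φ (MvPolynomial.monomial e c • m) = c * φ m)
  (h2 : ∀ a, ∀ m ∈ M.grading a, φ m ≠ 0 → 0 ≤ b + a)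

/-- The `S`-linear map `M → S` of degree `b` that sends `m ∈ Mₐ` to `φ(m) x^(b+a)`, where `φ` is an
additive functional with `φ(c x^e m) = c φ(m)` that vanishes on `Mₐ` unless `0 ≤ b + a`. Every
map of degree `b` arises in this way from exactly one `φ`. -/
def ofFunctional : M →ₗ[MvPolynomial (Fin n) k] ring n k :=
  linOfMonomial (ofFunctionalAux b φ) fun e c m => by
    induction m using M.homogeneous_induction with
    | h0 => simp
    | hadd x y hx hy => rw [smul_add, map_add, map_add, smul_add, hx, hy]
    | hom a m hm =>
      rw [ofFunctionalAux_apply b φ hm, ofFunctionalAux_apply b φ (M.monomial_smul_mem e c a m hm),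
        h1 e c a m hm, monomial_smul_term]
      by_cases h0 : φ m = 0
      · simp [h0]
      · have h3 := h2 a m hm h0
        have h4 := expo_add h3 (le_add_of_nonneg_right (a := b + a) (deg_nonneg e))
        rw [expo_add_deg] at h4
        rw [← add_assoc, ← h4, add_comm e]

theorem ofFunctional_apply {a : Fin n → ℤ} {m : M} (hm : m ∈ M.grading a) :
    ofFunctional b φ h1 h2 m = term (expo 0 (b + a)) (φ m) :=
  ofFunctionalAux_apply b φ hm

theorem ofFunctional_mem : ofFunctional b φ h1 h2 ∈ homGrading M (ring n k) b := by
  intro a m hm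
  rw [ofFunctional_apply b φ h1 h2 hm]
  by_cases h0 : φ m = 0
  · rw [h0, map_zero]; exact AddSubgroup.zero_mem _
  · have := term_mem (expo 0 (b + a)) (φ m)
    have h3 := add_deg_expo (h2 a m hm h0)
    rw [zero_add] at h3
    rwa [h3] at this

theorem coeffSum_ofFunctional {a : Fin n → ℤ} {m : M} (hm : m ∈ M.grading a) :
    coeffSum n k (ofFunctional b φ h1 h2 m) = φ m := by
  rw [ofFunctional_apply b φ h1 h2 hm, coeffSum_term]

end

theorem nonneg_of_coeffSum_ne_zero {M : GrMod n k} {b : Fin n → ℤ}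
    {f : M →ₗ[MvPolynomial (Fin n) k] ring n k}
    (hf : f ∈ homGrading M (ring n k) b) {a : Fin n → ℤ} {m : M} (hm : m ∈ M.grading a)
    (h : coeffSum n k (f m) ≠ 0) : 0 ≤ b + a :=
  (eq_term_of_mem (hf a m hm) fun h0 => h (by rw [h0, map_zero])).1

end GrMod

namespace GrMod
open MultiGraded
variable {n : ℕ} {k : Type u} [Field k]

/-! ### Pullbacks and the duality `Hom(-, S)` -/

section
variable {p q : (Fin n → ℤ) → (Fin n → ℤ)} (gc : GaloisConnection p q) {M : GrMod n k}

/-- The inclusion of `(q^*M)ₐ = M_{q(a)}` into `q^*M`. -/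
def pullOf (a : Fin n → ℤ) : M.grading (q a) →+ pullObj gc M := Pull.of (M := M) a

theorem pullOf_mem (a : Fin n → ℤ) (m : M.grading (q a)) :
    pullOf gc a m ∈ (pullObj gc M).grading a := ⟨m, rfl⟩

theorem exists_pullOf {a : Fin n → ℤ} {x : pullObj gc M} (hx : x ∈ (pullObj gc M).grading a) :
    ∃ m, pullOf gc a m = x := hx

theorem monomial_smul_pullOf {a a' : Fin n → ℤ} (e : Fin n →₀ ℕ) (ha : a' = a + deg e) (c : k)
    (m : M.grading (q a)) (m' : M.grading (q a'))
    (hm : (m' : M) = MvPolynomial.monomial (expo (q a) (q a')) c • (m : M)) :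
    MvPolynomial.monomial e c • pullOf gc a m = pullOf gc a' m' :=
  (pullObj_monomial_smul gc M e c _).trans (Pull.act_of_eq gc.monotone_u e c m m' ha hm)

theorem exists_monomial_smul_pullOf (e : Fin n →₀ ℕ) (c : k) (a : Fin n → ℤ) (m : M.grading (q a)) :
    ∃ h, MvPolynomial.monomial e c • pullOf gc a m = pullOf gc (a + deg e)
      ⟨MvPolynomial.monomial (expo (q a) (q (a + deg e))) c • (m : M), h⟩ := by
  obtain ⟨h, e1⟩ := Pull.act_of gc.monotone_u e c a m
  exact ⟨h, (pullObj_monomial_smul gc M e c _).trans e1⟩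

/-- Additive maps out of `q^*M` from additive maps out of its graded pieces. -/
def pullLift {B : Type*} [AddCommMonoid B] (f : ∀ a, M.grading (q a) →+ B) : pullObj gc M →+ B :=
  Pull.lift f

theorem pullLift_of {B : Type*} [AddCommMonoid B] (f : ∀ a, M.grading (q a) →+ B) (a : Fin n → ℤ)
    (m : M.grading (q a)) : pullLift gc f (pullOf gc a m) = f a m := Pull.lift_of _ _ _

theorem pullMap_pullOf {N : GrMod n k} (f : M ⟶ N) (a : Fin n → ℤ) (m : M.grading (q a)) :
    (pullMap gc f).toLin (pullOf gc a m) = pullOf gc a (Hom.restrict f (q a) m) :=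
  pullMap_of gc f a m

include gc in
/-- Multiplication with a monomial moves every element of degree `a` up to degree `q(p(a))`. -/
theorem monomial_smul_mem_unit {a : Fin n → ℤ} {m : M} (hm : m ∈ M.grading a) :
    MvPolynomial.monomial (expo a (q (p a))) (1 : k) • m ∈ M.grading (q (p a)) := by
  have := M.monomial_smul_mem (expo a (q (p a))) 1 a m hm
  rwa [add_deg_expo (gc.le_u_l a)] at this

end

/-- An element of `Hom_S(M, N)` as a linear map. -/
def homLin {M N : GrMod n k} : homObj M N →ₗ[MvPolynomial (Fin n) k]
    (M →ₗ[MvPolynomial (Fin n) k] N) := LinearMap.id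

theorem homLin_mem {M N : GrMod n k} {b : Fin n → ℤ} {f : homObj M N}
    (hf : f ∈ (homObj M N).grading b) : homLin f ∈ homGrading M N b := hf

/-- An element of degree `b` of `Hom_S(M, S)` is determined by the sums of coefficients of its
values. -/
theorem homObj_ring_ext {M : GrMod n k} {b : Fin n → ℤ} {f g : homObj M (ring n k)}
    (hf : f ∈ (homObj M (ring n k)).grading b) (hg : g ∈ (homObj M (ring n k)).grading b)
    (h : ∀ a, ∀ m ∈ M.grading a, coeffSum n k (homLin f m) = coeffSum n k (homLin g m)) : f = g :=
  hom_ring_ext hf hg h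

section
variable {p q p' q' : (Fin n → ℤ) → (Fin n → ℤ)} (gc : GaloisConnection p q)
  (gc' : GaloisConnection p' q') (h : ∀ a b, 0 ≤ q' b + a ↔ 0 ≤ b + p a)

/-- The functional `⨁ₐ M_{q(a)} → k` induced by an `S`-linear map `f : M → S`: it sends
`m ∈ M_{q(a)}` to the sum of the coefficients of `f(m)`. -/
def pullFunctional {M : GrMod n k} (f : homObj M (ring n k)) : pullObj gc M →+ k :=
  pullLift gc fun a =>
    (coeffSum n k).comp ((homLin f).toAddMonoidHom.comp (M.grading (q a)).subtype)

theorem pullFunctional_of {M : GrMod n k} (f : homObj M (ring n k)) (a : Fin n → ℤ)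
    (m : M.grading (q a)) : pullFunctional gc f (pullOf gc a m) = coeffSum n k (homLin f m) :=
  pullLift_of gc _ _ _

theorem pullFunctional_smul {M : GrMod n k} (f : homObj M (ring n k)) (e : Fin n →₀ ℕ) (c : k)
    (a : Fin n → ℤ) (m : pullObj gc M) (hm : m ∈ (pullObj gc M).grading a) :
    pullFunctional gc f (MvPolynomial.monomial e c • m) = c * pullFunctional gc f m := by
  obtain ⟨m, rfl⟩ := exists_pullOf gc hm
  obtain ⟨h, e1⟩ := exists_monomial_smul_pullOf gc e c a m
  rw [e1, pullFunctional_of, pullFunctional_of]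
  change coeffSum n k (homLin f (MvPolynomial.monomial _ c • (m : M))) = _
  rw [map_smul, coeffSum_monomial_smul]

include h in
theorem pullFunctional_nonneg {M : GrMod n k} {b : Fin n → ℤ} (f : homObj M (ring n k))
    (hf : f ∈ (homObj M (ring n k)).grading (q' b)) (a : Fin n → ℤ) (m : pullObj gc M)
    (hm : m ∈ (pullObj gc M).grading a) (h0 : pullFunctional gc f m ≠ 0) : 0 ≤ b + a := by
  obtain ⟨m, rfl⟩ := exists_pullOf gc hm
  rw [pullFunctional_of] at h0
  have h1 := nonneg_of_coeffSum_ne_zero (homLin_mem hf) m.2 h0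
  exact ((h _ _).1 h1).trans (by simpa using gc.l_u_le a)

/-- The map `Hom_S(M, S)_{q'(b)} → Hom_S(q^*M, S)` underlying `dualHom`. -/
def dualOfDegreeAux {M : GrMod n k} (b : Fin n → ℤ) (f : (homObj M (ring n k)).grading (q' b)) :
    homObj (pullObj gc M) (ring n k) :=
  ofFunctional b (pullFunctional gc f.1) (pullFunctional_smul gc f.1)
    (pullFunctional_nonneg gc h f.1 f.2)

theorem dualOfDegreeAux_mem {M : GrMod n k} (b : Fin n → ℤ)
    (f : (homObj M (ring n k)).grading (q' b)) :
    dualOfDegreeAux gc h b f ∈ (homObj (pullObj gc M) (ring n k)).grading b :=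
  ofFunctional_mem b (pullFunctional gc f.1) (pullFunctional_smul gc f.1)
    (pullFunctional_nonneg gc h f.1 f.2)

theorem coeffSum_dualOfDegreeAux {M : GrMod n k} (b : Fin n → ℤ)
    (f : (homObj M (ring n k)).grading (q' b)) (a : Fin n → ℤ) (m : M.grading (q a)) :
    coeffSum n k (homLin (dualOfDegreeAux gc h b f) (pullOf gc a m)) =
      coeffSum n k (homLin f.1 m) :=
  (coeffSum_ofFunctional b (pullFunctional gc f.1) (pullFunctional_smul gc f.1)
    (pullFunctional_nonneg gc h f.1 f.2) (pullOf_mem gc a m)).trans (pullFunctional_of gc _ a m)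

/-- An element of degree `b` of `Hom_S(q^*M, S)` is determined by the sums of coefficients of its
values on the pieces `M_{q(a)}`. -/
theorem homObj_pull_ext {M : GrMod n k} {b : Fin n → ℤ} {f g : homObj (pullObj gc M) (ring n k)}
    (hf : f ∈ (homObj (pullObj gc M) (ring n k)).grading b)
    (hg : g ∈ (homObj (pullObj gc M) (ring n k)).grading b)
    (h : ∀ a (m : M.grading (q a)), coeffSum n k (homLin f (pullOf gc a m)) =
      coeffSum n k (homLin g (pullOf gc a m))) : f = g :=
  homObj_ring_ext hf hg fun a m hm => by
    obtain ⟨m, rfl⟩ := exists_pullOf gc hm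
    exact h a m

/-- The additive map `Hom_S(M, S)_{q'(b)} → Hom_S(q^*M, S)` underlying `dualHom`. -/
def dualOfDegree (M : GrMod n k) (b : Fin n → ℤ) :
    (homObj M (ring n k)).grading (q' b) →+ homObj (pullObj gc M) (ring n k) :=
  AddMonoidHom.mk' (dualOfDegreeAux gc h b) fun f g =>
    homObj_pull_ext gc (dualOfDegreeAux_mem gc h b _)
      (AddSubgroup.add_mem _ (dualOfDegreeAux_mem gc h b _) (dualOfDegreeAux_mem gc h b _))
      fun a m => by
    rw [map_add, LinearMap.add_apply, map_add, coeffSum_dualOfDegreeAux, coeffSum_dualOfDegreeAux,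
      coeffSum_dualOfDegreeAux, AddSubgroup.coe_add, map_add, LinearMap.add_apply, map_add]

theorem dualOfDegree_mem (M : GrMod n k) (b : Fin n → ℤ)
    (f : (homObj M (ring n k)).grading (q' b)) :
    dualOfDegree gc h M b f ∈ (homObj (pullObj gc M) (ring n k)).grading b :=
  dualOfDegreeAux_mem gc h b f

theorem coeffSum_dualOfDegree (M : GrMod n k) (b : Fin n → ℤ)
    (f : (homObj M (ring n k)).grading (q' b)) (a : Fin n → ℤ) (m : M.grading (q a)) :
    coeffSum n k (homLin (dualOfDegree gc h M b f) (pullOf gc a m)) =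
      coeffSum n k (homLin f.1 m) :=
  coeffSum_dualOfDegreeAux gc h b f a m

/-- The natural map `q'^*Hom_S(M, S) → Hom_S(q^*M, S)`: it sends `f ∈ Hom_S(M, S)_{q'(b)}` to the
map of degree `b` whose value on `m ∈ (q^*M)ₐ = M_{q(a)}` is `c x^(b+a)` if `f(m)` is
`c x^(q'(b)+q(a))`. -/
def dualHom (M : GrMod n k) :
    pullObj gc' (homObj M (ring n k)) ⟶ homObj (pullObj gc M) (ring n k) where
  toLin := linOfMonomial (pullLift gc' (dualOfDegree gc h M)) fun e c x => by
    induction x using (pullObj gc' (homObj M (ring n k))).homogeneous_induction with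
    | h0 => simp
    | hadd x y hx hy => rw [smul_add, map_add, map_add, smul_add, hx, hy]
    | hom b x hx =>
      obtain ⟨f, rfl⟩ := exists_pullOf gc' hx
      obtain ⟨hf, e1⟩ := exists_monomial_smul_pullOf gc' e c b f
      rw [e1, pullLift_of, pullLift_of]
      refine homObj_pull_ext gc (dualOfDegree_mem gc h M _ _)
        ((homObj (pullObj gc M) (ring n k)).monomial_smul_mem e c b _ (dualOfDegree_mem gc h M _ _))
        fun a m => ?_
      rw [coeffSum_dualOfDegree, map_smul, map_smul, LinearMap.smul_apply, LinearMap.smul_apply,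
        coeffSum_monomial_smul, coeffSum_monomial_smul, coeffSum_dualOfDegree]
  map_mem b x hx := by
    obtain ⟨f, rfl⟩ := exists_pullOf gc' hx
    have := dualOfDegree_mem gc h M b f
    rwa [← pullLift_of gc' (dualOfDegree gc h M) b f] at this

theorem dualHom_of (M : GrMod n k) (b : Fin n → ℤ) (f : (homObj M (ring n k)).grading (q' b)) :
    (dualHom gc gc' h M).toLin (pullOf gc' b f) = dualOfDegree gc h M b f :=
  pullLift_of gc' _ _ _

theorem dualHom_injective (M : GrMod n k) : Function.Injective (dualHom gc gc' h M).toLin := by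
  refine injective_of_homogeneous _ fun b x hx h0 => ?_
  obtain ⟨f, rfl⟩ := exists_pullOf gc' hx
  rw [dualHom_of] at h0
  suffices f = 0 by rw [this, map_zero]
  refine Subtype.ext (homObj_ring_ext f.2 (AddSubgroup.zero_mem _) fun a m hm => ?_)
  -- The functional of `f` takes the same value on `m` and on `x^{q(p(a))-a} m`, and the latter lies
  -- in a graded piece of `q^*M`.
  have h1 := coeffSum_dualOfDegree gc h M b f (p a) ⟨_, monomial_smul_mem_unit gc hm⟩
  rw [h0, map_smul, coeffSum_monomial_smul, one_mul] at h1
  rw [← h1]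
  simp

/-- The functional on `M` induced by an `S`-linear map `g : q^*M → S`: it sends `m ∈ Mₐ` to the sum
of the coefficients of `g(x^{q(p(a))-a} m)`, where `x^{q(p(a))-a} m` is taken in degree `p(a)`. -/
def extendFunctional {M : GrMod n k} (g : homObj (pullObj gc M) (ring n k)) : M →+ k :=
  (DirectSum.toAddMonoid fun a => (coeffSum n k).comp <| (homLin g).toAddMonoidHom.comp <|
    (pullOf gc (p a)).comp <| AddMonoidHom.mk' (fun m : M.grading a =>
      (⟨_, monomial_smul_mem_unit gc m.2⟩ : M.grading (q (p a)))) fun _ _ =>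
        Subtype.ext (smul_add _ _ _)).comp M.decomp.toAddMonoidHom

theorem extendFunctional_apply {M : GrMod n k} (g : homObj (pullObj gc M) (ring n k))
    {a : Fin n → ℤ} {m : M} (hm : m ∈ M.grading a) :
    extendFunctional gc g m =
      coeffSum n k (homLin g (pullOf gc (p a) ⟨_, monomial_smul_mem_unit gc hm⟩)) := by
  change DirectSum.toAddMonoid _ (M.decomp m) = _
  rw [M.decomp_of_mem hm, DirectSum.toAddMonoid_of]
  rfl

theorem coeffSum_pullOf {M : GrMod n k} (g : homObj (pullObj gc M) (ring n k))
    {a a' : Fin n → ℤ} (ha : a ≤ a') (c : k) (m : M.grading (q a)) (m' : M.grading (q a'))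
    (hm : (m' : M) = MvPolynomial.monomial (expo (q a) (q a')) c • (m : M)) :
    coeffSum n k (homLin g (pullOf gc a' m')) = c * coeffSum n k (homLin g (pullOf gc a m)) := by
  rw [← monomial_smul_pullOf gc (expo a a') (add_deg_expo ha).symm c m m' hm, map_smul,
    coeffSum_monomial_smul]

theorem dualHom_surjective (M : GrMod n k) : Function.Surjective (dualHom gc gc' h M).toLin := by
  refine surjective_of_homogeneous _ fun b g hg => ?_
  have h1 : ∀ (e : Fin n →₀ ℕ) (c : k) a, ∀ m ∈ M.grading a,
      extendFunctional gc g (MvPolynomial.monomial e c • m) = c * extendFunctional gc g m := by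
    intro e c a m hm
    rw [extendFunctional_apply gc g hm,
      extendFunctional_apply gc g (M.monomial_smul_mem e c a m hm)]
    have hle : a ≤ a + deg e := le_add_of_nonneg_right (deg_nonneg e)
    -- Both sides reduce to `x^{q(p(a+e))-a}`, factored through degrees `a + e` and `q(p(a))`.
    refine coeffSum_pullOf gc g (gc.monotone_l hle) c _ _ ?_
    change MvPolynomial.monomial _ (1 : k) • MvPolynomial.monomial e c • m =
      MvPolynomial.monomial _ c • MvPolynomial.monomial _ (1 : k) • m
    rw [← mul_smul, ← mul_smul, MvPolynomial.monomial_mul, MvPolynomial.monomial_mul, one_mul,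
      mul_one]
    have e1 := expo_add hle (gc.le_u_l (a + deg e))
    have e2 := expo_add (gc.le_u_l a) (gc.monotone_u (gc.monotone_l hle))
    rw [expo_add_deg] at e1
    rw [add_comm (expo _ _) e, e1, add_comm (expo (q _) _), e2]
  have h2 : ∀ a, ∀ m ∈ M.grading a, extendFunctional gc g m ≠ 0 → 0 ≤ q' b + a := by
    intro a m hm h0
    rw [extendFunctional_apply gc g hm] at h0
    exact (h a b).2 (nonneg_of_coeffSum_ne_zero (homLin_mem hg) (pullOf_mem gc _ _) h0)
  let f : (homObj M (ring n k)).grading (q' b) :=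
    ⟨ofFunctional (q' b) (extendFunctional gc g) h1 h2, ofFunctional_mem _ _ _ _⟩
  refine ⟨pullOf gc' b f, ?_⟩
  rw [dualHom_of]
  refine homObj_pull_ext gc (dualOfDegree_mem gc h M _ _) hg fun a m => ?_
  rw [coeffSum_dualOfDegree]
  refine (coeffSum_ofFunctional (q' b) _ h1 h2 m.2).trans ?_
  rw [extendFunctional_apply gc g m.2]
  -- On `q^*M` the extension gives back the functional of `g`, as `q(p(q(a))) = q(a)`.
  refine Eq.symm ((coeffSum_pullOf gc g (gc.l_u_le a) 1 ⟨_, monomial_smul_mem_unit gc m.2⟩ m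
    ?_).trans (one_mul _))
  rw [← mul_smul, MvPolynomial.monomial_mul, add_comm,
    expo_add (gc.le_u_l (q a)) (gc.monotone_u (gc.l_u_le a)), expo_self, one_mul]
  exact (one_smul _ _).symm

/-- `dualHom` as an isomorphism. -/
def dualIso (M : GrMod n k) :
    pullObj gc' (homObj M (ring n k)) ≅ homObj (pullObj gc M) (ring n k) :=
  have := isIso_of_bijective _ (dualHom_injective gc gc' h M) (dualHom_surjective gc gc' h M)
  asIso (dualHom gc gc' h M)

/-- Composition with a morphism, on `Hom_S(-, S)`. -/
def dualMap {M N : GrMod n k} (φ : N ⟶ M) : homObj M (ring n k) ⟶ homObj N (ring n k) :=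
  (homFunctor (ring n k)).map φ.op

theorem homLin_dualMap {M N : GrMod n k} (φ : N ⟶ M) (f : homObj M (ring n k)) (m : N) :
    homLin ((dualMap φ).toLin f) m = homLin f (φ.toLin m) := rfl

theorem dualHom_naturality {M N : GrMod n k} (φ : N ⟶ M) :
    pullMap gc' (dualMap φ) ≫ dualHom gc gc' h N =
      dualHom gc gc' h M ≫ dualMap (pullMap gc φ) := by
  refine pull_hom_ext gc' fun b f => ?_
  change (dualHom gc gc' h N).toLin ((pullMap gc' (dualMap φ)).toLin (pullOf gc' b f)) =
    (dualMap (pullMap gc φ)).toLin ((dualHom gc gc' h M).toLin (pullOf gc' b f))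
  rw [pullMap_pullOf, dualHom_of, dualHom_of]
  refine homObj_pull_ext gc (dualOfDegree_mem gc h N _ _)
    ((dualMap (pullMap gc φ)).map_mem b _ (dualOfDegree_mem gc h M b f)) fun a m => ?_
  rw [coeffSum_dualOfDegree, homLin_dualMap, pullMap_pullOf, coeffSum_dualOfDegree]
  rfl

/-- Duality exchanges the pullbacks `q^*` and `q'^*` if they have dual effects on `S(-a)` and
`S(a)`: the condition `h` says that `S(-p(a)) ≅ q^*(S(-a))` is dual to `q'^*(S(a))`. -/
def dualPullIso :
    (pull (k := k) gc).op ⋙ homFunctor (ring n k) ≅ homFunctor (ring n k) ⋙ pull gc' :=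
  (NatIso.ofComponents (fun M => dualIso gc gc' h M.unop)
    fun φ => dualHom_naturality gc gc' h φ.unop).symm

end

theorem lam_dual_tau (i : Fin n) (j : ℤ) (a b : Fin n → ℤ) :
    0 ≤ lam i (-j) b + a ↔ 0 ≤ b + tau i j a := by
  simp only [Pi.le_def, Pi.add_apply, Pi.zero_apply, lam, tau]
  refine forall_congr' fun l => ?_
  by_cases hl : l = i
  · subst hl
    simp only [Function.update_self]
    split_ifs <;> lia
  · simp [Function.update_of_ne hl]

theorem sigma_dual_rho (i : Fin n) (j : ℤ) (a b : Fin n → ℤ) :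
    0 ≤ sigma i (-j) b + a ↔ 0 ≤ b + rho i j a := by
  simp only [Pi.le_def, Pi.add_apply, Pi.zero_apply, sigma, rho]
  refine forall_congr' fun l => ?_
  by_cases hl : l = i
  · subst hl
    simp only [Function.update_self]
    split_ifs <;> lia
  · simp [Function.update_of_ne hl]

end GrMod

namespace GrMod
open MultiGraded
variable {n : ℕ} {k : Type u} [Field k]

/-! ### Pullbacks of projectives -/

theorem expo_zero_neg_add (a b : Fin n → ℤ) : expo 0 (-a + b) = expo a b := by
  ext i; simp [expo, neg_add_eq_sub]

/-- An element of `S`, as an element of the free module `S(-a)`. -/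
def toShift (a : Fin n → ℤ) : ring n k →ₗ[MvPolynomial (Fin n) k] (ring n k).shift (-a) :=
  LinearMap.id

theorem toShift_mem {a b : Fin n → ℤ} {f : ring n k} :
    toShift a f ∈ ((ring n k).shift (-a)).grading b ↔ f ∈ (ring n k).grading (-a + b) := Iff.rfl

theorem toShift_term_mem {a b : Fin n → ℤ} (h : a ≤ b) (c : k) :
    toShift a (term (expo a b) c) ∈ ((ring n k).shift (-a)).grading b := by
  rw [toShift_mem]
  have := term_mem (expo a b) c
  rwa [← add_deg_expo h, neg_add_cancel_left, add_deg_expo h]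

theorem toShift_surjective (a : Fin n → ℤ) : Function.Surjective (toShift (k := k) a) :=
  Function.surjective_id

theorem exists_eq_toShift_term {a b : Fin n → ℤ} {x : (ring n k).shift (-a)}
    (hx : x ∈ ((ring n k).shift (-a)).grading b) (h0 : x ≠ 0) :
    ∃ _ : a ≤ b, ∃ c ≠ 0, x = toShift a (term (expo a b) c) := by
  obtain ⟨x, rfl⟩ := toShift_surjective a x
  rw [toShift_mem] at hx
  obtain ⟨h1, h2⟩ := eq_term_of_mem hx h0
  rw [le_neg_add_iff_add_le, add_zero] at h1
  rw [expo_zero_neg_add] at h2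
  refine ⟨h1, coeffSum n k x, fun h => h0 ?_, congrArg _ h2⟩
  rw [h2, h, map_zero, map_zero]

theorem ofElement_toShift_term {M : GrMod n k} {a : Fin n → ℤ} {m : M} (hm : m ∈ M.grading a)
    (e : Fin n →₀ ℕ) (c : k) :
    (ofElement hm).toLin (toShift a (term e c)) = MvPolynomial.monomial e c • m := rfl

section
variable {p q : (Fin n → ℤ) → (Fin n → ℤ)} (gc : GaloisConnection p q) (a : Fin n → ℤ)

/-- The generator `x^{q(p(a))-a}` of degree `p(a)` of `q^*(S(-a))`. -/
def pullGenerator : pullObj gc ((ring n k).shift (-a)) :=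
  pullOf gc (p a) ⟨toShift a (term (expo a (q (p a))) 1), toShift_term_mem (gc.le_u_l a) 1⟩

theorem pullGenerator_mem : pullGenerator (k := k) gc a ∈
    (pullObj gc ((ring n k).shift (-a))).grading (p a) := pullOf_mem gc _ _

theorem monomial_smul_pullGenerator {b : Fin n → ℤ} (hb : p a ≤ b) (c : k) :
    MvPolynomial.monomial (expo (p a) b) c • pullGenerator gc a =
      pullOf gc b ⟨toShift a (term (expo a (q b)) c), toShift_term_mem ((gc _ _).1 hb) c⟩ := by
  refine monomial_smul_pullOf gc _ (add_deg_expo hb).symm c _ _ ?_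
  change toShift a (term (expo a (q b)) c) =
    MvPolynomial.monomial _ c • toShift a (term (expo a (q (p a))) 1)
  rw [← map_smul, monomial_smul_term, mul_one, add_comm,
    expo_add (gc.le_u_l a) (gc.monotone_u hb)]

/-- The isomorphism `S(-p(a)) ≅ q^*(S(-a))`. -/
def shiftIso : (ring n k).shift (-p a) ≅ pullObj gc ((ring n k).shift (-a)) := by
  let f : (ring n k).shift (-p a) ⟶ pullObj gc ((ring n k).shift (-a)) :=
    ofElement (pullGenerator_mem gc a)
  have hi : Function.Injective f.toLin := by
    refine injective_of_homogeneous f fun b x hx h0 => ?_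
    by_contra hne
    obtain ⟨hb, c, hc, rfl⟩ := exists_eq_toShift_term hx hne
    have h1 : f.toLin (toShift (p a) (term (expo (p a) b) c)) = _ :=
      monomial_smul_pullGenerator gc a hb c
    rw [h0] at h1
    have h2 := congrArg (pullLift gc fun b => ((coeffSum n k).comp
      (((ring n k).shift (-a)).grading (q b)).subtype : _ →+ k)) h1
    rw [map_zero, pullLift_of] at h2
    exact hc (h2.trans (coeffSum_term _ _)).symm
  have hs : Function.Surjective f.toLin := by
    refine surjective_of_homogeneous f fun b y hy' => ?_
    obtain ⟨⟨y, hy⟩, rfl⟩ := exists_pullOf gc hy'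
    by_cases h0 : y = 0
    · subst h0
      exact ⟨0, (map_zero _).trans (map_zero (pullOf gc b)).symm⟩
    · obtain ⟨h1, c, -, rfl⟩ := exists_eq_toShift_term hy h0
      exact ⟨_, monomial_smul_pullGenerator gc a ((gc _ _).2 h1) c⟩
  have := isIso_of_bijective f hi hs
  exact asIso f

end

/-- A projective object is a retract of a finite sum of free modules `S(-a)`. -/
theorem exists_retract_of_projective (P : GrMod n k) [Projective P] :
    ∃ (r : ℕ) (a : Fin r → (Fin n → ℤ)),
      Nonempty (Retract P (∐ fun l : ULift.{u} (Fin r) => (ring n k).shift (-(a l.down)))) := by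
  obtain ⟨r, a, m, hm, hs⟩ := P.exists_generators
  let π : (∐ fun l : ULift.{u} (Fin r) => (ring n k).shift (-(a l.down))) ⟶ P :=
    Sigma.desc fun l => ofElement (hm l.down)
  have hπ : Epi π := by
    refine Preadditive.epi_of_cancel_zero _ fun {P} g hg => ?_
    refine Hom.ext (LinearMap.ext_on_range hs fun l => ?_)
    have h1 : ofElement (hm l) ≫ g = 0 := by
      have : ofElement (hm l) =
          Sigma.ι (fun l : ULift.{u} (Fin r) => (ring n k).shift (-(a l.down))) ⟨l⟩ ≫ π := by
        simp [π]
      rw [this, Category.assoc, hg, comp_zero]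
    have h2 := LinearMap.congr_fun (congrArg Hom.toLin h1) (1 : MvPolynomial (Fin n) k)
    change g.toLin ((ofElement (hm l)).toLin (1 : MvPolynomial (Fin n) k)) = 0 at h2
    rwa [ofElement_one] at h2
  exact ⟨r, a, ⟨{ i := Projective.factorThru (𝟙 P) π, r := π, retract := by simp }⟩⟩

instance {p q : (Fin n → ℤ) → (Fin n → ℤ)} (gc : GaloisConnection p q) :
    (pull (k := k) gc).PreservesProjectiveObjects where
  projective_obj {P} _ := by
    obtain ⟨r, a, ⟨ρ⟩⟩ := exists_retract_of_projective P
    have : ∀ l : ULift.{u} (Fin r),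
        Projective (pullObj gc ((ring n k).shift (-(a l.down)))) :=
      fun l => Projective.of_iso (shiftIso gc (a l.down)) inferInstance
    have : ∀ l : ULift.{u} (Fin r),
        Projective ((pull gc).obj ((ring n k).shift (-(a l.down)))) := this
    have h2 : Projective ((pull gc).obj
        (∐ fun l : ULift.{u} (Fin r) => (ring n k).shift (-(a l.down)))) :=
      Projective.of_iso (PreservesCoproduct.iso (pull gc) _).symm inferInstance
    exact (ρ.map (pull gc)).projective

end GrMod

namespace GrMod
open MultiGraded
variable {n : ℕ} {k : Type u} [Field k]

/-! ### Finite projective dimension -/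

theorem shortExact_of_injective {M N : GrMod n k} (f : M ⟶ N)
    (hf : Function.Injective f.toLin) :
    (ShortComplex.mk f (cokerπ f) (comp_cokerπ f)).ShortExact where
  exact := (exact_iff _).2 fun _ h => cokerπ_eq_zero f h
  mono_f := mono_of_injective f hf
  epi_g := epi_of_surjective _ (cokerπ_surjective f)

/-- `g` is a generator of degree `a` of `C`, and its annihilator is the prime ideal generated by
the variables `x_i`, `i ∈ T`. So `C` is isomorphic to `(S/(x_i : i ∈ T))(-a)`. -/
structure IsCyclicGenerator (T : Finset (Fin n)) (a : Fin n → ℤ) (C : GrMod n k) (g : C) : Prop where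
  mem : g ∈ C.grading a
  surjective : Function.Surjective (ofElement mem).toLin
  smul_eq_zero_iff : ∀ (e : Fin n →₀ ℕ) (c : k),
    MvPolynomial.monomial e c • g = 0 ↔ c = 0 ∨ ∃ i ∈ T, e i ≠ 0

namespace IsCyclicGenerator
variable {T : Finset (Fin n)} {a : Fin n → ℤ} {C : GrMod n k} {g : C}

theorem exists_eq_monomial_smul (hg : IsCyclicGenerator T a C g) {b : Fin n → ℤ} {y : C}
    (hy : y ∈ C.grading b) (h0 : y ≠ 0) :
    ∃ _ : a ≤ b, ∃ c : k, y = MvPolynomial.monomial (expo a b) c • g := by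
  obtain ⟨x, hx⟩ := hg.surjective y
  have h1 : (ofElement hg.mem).toLin (((ring n k).shift (-a)).proj b x) = y := by
    rw [map_proj, hx, C.proj_of_mem hy]
  have hne : ((ring n k).shift (-a)).proj b x ≠ 0 := fun h => h0 (by rw [← h1, h, map_zero])
  obtain ⟨hab, c, -, h2⟩ := exists_eq_toShift_term (proj_mem _ b x) hne
  rw [h2] at h1
  exact ⟨hab, c, h1.symm⟩

theorem exists_hom (hg : IsCyclicGenerator T a C g) {M : GrMod n k} {m : M} (hm : m ∈ M.grading a)
    (hT : ∀ i ∈ T, (MvPolynomial.X i : MvPolynomial (Fin n) k) • m = 0) :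
    ∃ φ : C ⟶ M, φ.toLin g = m := by
  have hmono : ∀ (e : Fin n →₀ ℕ) (c : k), (∃ i ∈ T, e i ≠ 0) →
      MvPolynomial.monomial e c • m = 0 := by
    rintro e c ⟨i, hi, he⟩
    have h1 : e = (e - Finsupp.single i 1) + Finsupp.single i 1 :=
      (tsub_add_cancel_of_le (Finsupp.single_le_iff.2 (Nat.one_le_iff_ne_zero.2 he))).symm
    rw [h1, ← mul_one c, ← MvPolynomial.monomial_mul, mul_smul]
    have := hT i hi
    rw [MvPolynomial.X] at this
    rw [this, smul_zero]
  have hker : ∀ x, (ofElement hg.mem).toLin x = 0 → (ofElement hm).toLin x = 0 := by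
    intro x hx
    refine M.eq_zero_of_proj fun b => ?_
    rw [← map_proj]
    by_cases h0 : ((ring n k).shift (-a)).proj b x = 0
    · rw [h0, map_zero]
    · obtain ⟨hab, c, hc, h2⟩ := exists_eq_toShift_term (proj_mem _ b x) h0
      have h3 : (ofElement hg.mem).toLin (((ring n k).shift (-a)).proj b x) = 0 := by
        rw [map_proj, hx, map_zero]
      rw [h2, ofElement_toShift_term] at h3 ⊢
      exact hmono _ _ (((hg.smul_eq_zero_iff _ _).1 h3).resolve_left hc)
  refine ⟨descSurj _ hg.surjective (ofElement hm) hker, ?_⟩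
  have h1 := LinearMap.congr_fun (congrArg Hom.toLin
    (comp_descSurj _ hg.surjective (ofElement hm) hker)) (1 : MvPolynomial (Fin n) k)
  have h2 := ofElement_one hm
  rw [← h1] at h2
  refine Eq.trans ?_ h2
  exact congrArg (descSurj _ hg.surjective (ofElement hm) hker).toLin (ofElement_one hg.mem).symm

theorem injective_of_hom (hg : IsCyclicGenerator T a C g) {M : GrMod n k} (φ : C ⟶ M)
    (h : ∀ (e : Fin n →₀ ℕ) (c : k), (∀ i ∈ T, e i = 0) →
      MvPolynomial.monomial e c • φ.toLin g = 0 → c = 0) : Function.Injective φ.toLin := by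
  refine injective_of_homogeneous φ fun b y hy hφ => ?_
  by_contra h0
  obtain ⟨hab, c, rfl⟩ := hg.exists_eq_monomial_smul hy h0
  rw [map_smul] at hφ
  refine h0 ((hg.smul_eq_zero_iff _ _).2 ?_)
  by_cases hT : ∀ i ∈ T, expo a b i = 0
  · exact Or.inl (h _ _ hT hφ)
  · push Not at hT
    exact Or.inr hT

end IsCyclicGenerator

theorem isCyclicGenerator_shift (a : Fin n → ℤ) :
    IsCyclicGenerator (k := k) ∅ a ((ring n k).shift (-a)) (toShift a (term 0 1)) := by
  have hm := one_mem (n := n) (k := k) a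
  have h1 : ∀ x, (ofElement (M := (ring n k).shift (-a)) hm).toLin x = x := fun x =>
    mul_one (show MvPolynomial (Fin n) k from x)
  refine ⟨hm, fun x => ⟨x, h1 x⟩, fun e c => ?_⟩
  rw [← map_smul, monomial_smul_term, mul_one, add_zero]
  have : toShift a (term e c) = 0 ↔ c = 0 := MvPolynomial.monomial_eq_zero
  simpa using this

open IsCyclicGenerator in
/-- The modules `(S/(x_i : i ∈ T))(-a)` exist and have projective dimension at most `|T|`: there is a
short exact sequence that starts with multiplication by `x_i` on the module for `T`, and ends with
the module for `T ∪ {i}`. -/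
theorem exists_isCyclicGenerator (T : Finset (Fin n)) (a : Fin n → ℤ) :
    ∃ (C : GrMod n k) (g : C), IsCyclicGenerator T a C g ∧
      HasProjectiveDimensionLT C (T.card + 1) := by
  induction T using Finset.induction_on generalizing a with
  | empty =>
    exact ⟨_, _, isCyclicGenerator_shift a, projective_iff_hasProjectiveDimensionLT_one.1
      inferInstance⟩
  | insert i T hi ih =>
    obtain ⟨C₁, g₁, hg₁, hp₁⟩ := ih a
    obtain ⟨C₀, g₀, hg₀, hp₀⟩ := ih (a + deg (Finsupp.single i 1))
    -- `φ` is multiplication by `x_i`; it is injective because `i ∉ T`.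
    obtain ⟨φ, hφ⟩ := hg₀.exists_hom (C₁.monomial_smul_mem (Finsupp.single i 1) 1 a g₁ hg₁.mem)
      (fun l hl => by
        rw [MvPolynomial.X, ← mul_smul, MvPolynomial.monomial_mul, hg₁.smul_eq_zero_iff]
        exact Or.inr ⟨l, hl, by simp⟩)
    have hinj : Function.Injective φ.toLin := hg₀.injective_of_hom φ fun e c he h => by
      rw [hφ, ← mul_smul, MvPolynomial.monomial_mul, hg₁.smul_eq_zero_iff, mul_one] at h
      refine h.resolve_right ?_
      rintro ⟨l, hl, h⟩
      have hli : i ≠ l := fun h => hi (h ▸ hl)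
      simp [he l hl, hli] at h
    have hπ := (cokerπ φ).map_mem a _ hg₁.mem
    refine ⟨coker φ, (cokerπ φ).toLin g₁, ⟨hπ, ?_, fun e c => ?_⟩, ?_⟩
    · intro y
      obtain ⟨y, rfl⟩ := cokerπ_surjective φ y
      obtain ⟨x, rfl⟩ := hg₁.surjective y
      refine ⟨x, ?_⟩
      change (show MvPolynomial (Fin n) k from x) • (cokerπ φ).toLin g₁ =
        (cokerπ φ).toLin ((show MvPolynomial (Fin n) k from x) • g₁)
      rw [map_smul]
    · rw [← map_smul]
      constructor
      · intro h
        by_contra! hc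
        obtain ⟨hc, hT⟩ := hc
        obtain ⟨z, hz⟩ := cokerπ_eq_zero φ h
        have hmem := C₁.monomial_smul_mem e c a g₁ hg₁.mem
        have hne : MvPolynomial.monomial e c • g₁ ≠ 0 := by
          rw [Ne, hg₁.smul_eq_zero_iff]
          rintro (h | ⟨l, hl, h⟩)
          · exact hc h
          · exact h (hT l (Finset.mem_insert_of_mem hl))
        have hz' : φ.toLin (C₀.proj (a + deg e) z) = MvPolynomial.monomial e c • g₁ := by
          rw [map_proj, hz, C₁.proj_of_mem hmem]
        have hz0 : C₀.proj (a + deg e) z ≠ 0 := fun h => hne (by rw [← hz', h, map_zero])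
        -- `z` would have degree at least that of `g₀`, which is too large in the `i`-th coordinate.
        obtain ⟨hle, -⟩ := hg₀.exists_eq_monomial_smul (C₀.proj_mem _ z) hz0
        have := hle i
        simp [deg, hT i (Finset.mem_insert_self i T)] at this
      · intro h
        by_cases hz : c = 0 ∨ ∃ l ∈ T, e l ≠ 0
        · rw [(hg₁.smul_eq_zero_iff e c).2 hz, map_zero]
        · have hei : e i ≠ 0 := by
            rcases h with h | ⟨l, hl, h⟩
            · exact absurd (Or.inl h) hz
            · rcases Finset.mem_insert.1 hl with rfl | hl
              · exact h
              · exact absurd (Or.inr ⟨l, hl, h⟩) hz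
          have h1 : e = (e - Finsupp.single i 1) + Finsupp.single i 1 :=
            (tsub_add_cancel_of_le (Finsupp.single_le_iff.2 (Nat.one_le_iff_ne_zero.2 hei))).symm
          rw [h1, ← mul_one c, ← MvPolynomial.monomial_mul, mul_smul, ← hφ, ← map_smul]
          exact LinearMap.congr_fun (congrArg Hom.toLin (comp_cokerπ φ)) _
    · rw [Finset.card_insert_of_notMem hi]
      exact (shortExact_of_injective φ hinj).hasProjectiveDimensionLT_X₃ (T.card + 1) hp₀
        (hasProjectiveDimensionLT_of_ge C₁ (T.card + 1) _ (by lia))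

/-- A nonzero graded module contains some `(S/(x_i : i ∈ T))(-a)`: take a nonzero homogeneous element
that is killed by as many variables as possible. -/
theorem exists_prime_element {M : GrMod n k} (hM : ∃ m : M, m ≠ 0) :
    ∃ (T : Finset (Fin n)) (a : Fin n → ℤ) (m : M), m ∈ M.grading a ∧
      (∀ i ∈ T, (MvPolynomial.X i : MvPolynomial (Fin n) k) • m = 0) ∧
      ∀ (e : Fin n →₀ ℕ) (c : k), (∀ i ∈ T, e i = 0) → MvPolynomial.monomial e c • m = 0 → c = 0 := by
  classical
  let A : M → Finset (Fin n) := fun m =>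
    Finset.univ.filter fun i => (MvPolynomial.X i : MvPolynomial (Fin n) k) • m = 0
  have hA : ∀ m i, i ∈ A m ↔ (MvPolynomial.X i : MvPolynomial (Fin n) k) • m = 0 := by simp [A]
  have hne : {T | ∃ a, ∃ m ∈ M.grading a, m ≠ 0 ∧ A m = T}.Nonempty := by
    obtain ⟨m, hm⟩ := hM
    have : ∃ a, M.proj a m ≠ 0 := by
      by_contra! h
      exact hm (M.eq_zero_of_proj h)
    obtain ⟨a, ha⟩ := this
    exact ⟨_, a, _, M.proj_mem a m, ha, rfl⟩
  obtain ⟨T, hT⟩ := Set.Finite.exists_maximal (Set.toFinite _) hne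
  obtain ⟨a, m, hm, hm0, rfl⟩ := hT.prop
  refine ⟨A m, a, m, hm, fun i hi => (hA m i).1 hi, ?_⟩
  -- Induction on the total degree of the monomial. Multiplying `m` by variables outside `A m` does
  -- not enlarge the set of variables that kill it, by maximality.
  have key : ∀ (s : ℕ) (e : Fin n →₀ ℕ), ∑ i, e i = s → (∀ i ∈ A m, e i = 0) →
      MvPolynomial.monomial e (1 : k) • m ≠ 0 := by
    intro s
    induction s with
    | zero =>
      intro e he _
      have : e = 0 := by
        ext i
        exact (Finset.sum_eq_zero_iff.1 he) i (Finset.mem_univ i)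
      rw [this]
      exact (one_smul (MvPolynomial (Fin n) k) m).symm ▸ hm0
    | succ s ih =>
      intro e he heA
      obtain ⟨i, hi⟩ : ∃ i, e i ≠ 0 := by
        by_contra! h
        simp [h] at he
      have h1 : e = Finsupp.single i 1 + (e - Finsupp.single i 1) :=
        (add_tsub_cancel_of_le (Finsupp.single_le_iff.2 (Nat.one_le_iff_ne_zero.2 hi))).symm
      have h2 := ih (e - Finsupp.single i 1) (by
        rw [h1] at he
        simp only [Finsupp.add_apply, Finset.sum_add_distrib] at he
        simp [Finsupp.single_apply] at he ⊢
        lia) (fun l hl => by simp [heA l hl])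
      set e' := e - Finsupp.single i 1
      have h3 : A m ≤ A (MvPolynomial.monomial e' (1 : k) • m) := fun l hl => by
        rw [hA] at hl ⊢
        rw [smul_comm, hl, smul_zero]
      have h4 : A (MvPolynomial.monomial e' (1 : k) • m) ≤ A m :=
        hT.le_of_ge ⟨_, _, M.monomial_smul_mem e' 1 a m hm, h2, rfl⟩ h3
      intro h0
      rw [h1, ← mul_one (1 : k), ← MvPolynomial.monomial_mul, mul_smul] at h0
      exact hi (heA i (h4 ((hA _ i).2 h0)))
  intro e c he h
  by_contra hc
  refine key _ e rfl he ?_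
  have : MvPolynomial.monomial e (1 : k) = MvPolynomial.C c⁻¹ * MvPolynomial.monomial e c := by
    rw [MvPolynomial.C_mul_monomial, inv_mul_cancel₀ hc]
  rw [this, mul_smul, h, smul_zero]

/-- Hilbert's syzygy theorem for multigraded modules. The induction is on the kernel of a surjection
`M → N`, ordered by reverse inclusion: `N` contains some `C ≅ (S/(x_i : i ∈ T))(-a)`, and the kernel
of `M → N/C` is strictly larger. -/
theorem hasProjectiveDimensionLT (M : GrMod n k) : HasProjectiveDimensionLT M (n + 1) := by
  suffices ∀ (K : Submodule (MvPolynomial (Fin n) k) M) (N : GrMod n k) (f : M ⟶ N),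
      Function.Surjective f.toLin → LinearMap.ker f.toLin = K →
        HasProjectiveDimensionLT N (n + 1) from
    this _ M (𝟙 M) Function.surjective_id rfl
  intro K
  induction K using WellFoundedGT.induction with
  | ind K ih =>
  rintro N f hf rfl
  by_cases hN : ∃ y : N, y ≠ 0
  · obtain ⟨T, a, y, hy, h1, h2⟩ := exists_prime_element hN
    obtain ⟨C, g, hg, hC⟩ := exists_isCyclicGenerator (k := k) T a
    obtain ⟨φ, hφ⟩ := hg.exists_hom hy h1
    have hinj := hg.injective_of_hom φ (by rwa [hφ])
    have hy0 : y ≠ 0 := fun h => one_ne_zero (h2 0 1 (by simp) (by rw [h, smul_zero]))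
    refine (shortExact_of_injective φ hinj).hasProjectiveDimensionLT_X₂ (n + 1)
      (hasProjectiveDimensionLT_of_ge C (T.card + 1) _ ?_) ?_
    · simpa using T.card_le_univ
    · refine ih _ ?_ (coker φ) (f ≫ cokerπ φ) ((cokerπ_surjective φ).comp hf) rfl
      obtain ⟨x, rfl⟩ := hf y
      refine SetLike.lt_iff_le_and_exists.2 ⟨fun z hz => ?_, x, ?_, hy0⟩
      · rw [LinearMap.mem_ker] at hz ⊢
        rw [comp_toLin, LinearMap.comp_apply, hz, map_zero]
      · rw [LinearMap.mem_ker, comp_toLin, LinearMap.comp_apply, ← hφ]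
        exact LinearMap.congr_fun (congrArg Hom.toLin (comp_cokerπ φ)) g
  · push Not at hN
    have hz : IsZero N := by
      rw [IsZero.iff_id_eq_zero]
      ext y
      exact (hN _).trans (hN _).symm
    have := hz.hasProjectiveDimensionLT_zero
    exact hasProjectiveDimensionLT_of_ge N 0 _ (by lia)

end GrMod

namespace MultiGraded

/-! ### Derived functors and exact functors -/

section rightDerived

variable {A B : Type*} [Category* A] [Category* B] [Abelian A] [Abelian B]

/-- The image of an injective resolution under an exact functor that preserves injectives. -/
def mapInjectiveResolution (H : A ⥤ A) [H.Additive] [PreservesFiniteLimits H]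
    [PreservesFiniteColimits H] [H.PreservesInjectiveObjects] {X : A} (I : InjectiveResolution X) :
    InjectiveResolution (H.obj X) where
  cocomplex := (H.mapHomologicalComplex _).obj I.cocomplex
  injective m := H.injective_obj_of_injective (I.injective m)
  ι := (HomologicalComplex.singleMapHomologicalComplex H (ComplexShape.up ℕ) 0).inv.app X ≫
    (H.mapHomologicalComplex _).map I.ι
  quasiIso := inferInstance

theorem mapInjectiveResolution_ι_f_zero (H : A ⥤ A) [H.Additive] [PreservesFiniteLimits H]
    [PreservesFiniteColimits H] [H.PreservesInjectiveObjects] {X : A} (I : InjectiveResolution X) :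
    (mapInjectiveResolution H I).ι.f 0 = H.map (I.ι.f 0) := by
  simp [mapInjectiveResolution]
  exact Category.id_comp _

omit [Abelian B] in
/-- Pasting of four commutative squares. -/
theorem paste_four {a₀ a₁ a₂ a₃ a₄ b₀ b₁ b₂ b₃ b₄ : B} {u₀ : a₀ ⟶ b₀} {u₁ : a₁ ⟶ b₁} {u₂ : a₂ ⟶ b₂}
    {u₃ : a₃ ⟶ b₃} {u₄ : a₄ ⟶ b₄} {f₀ : a₀ ⟶ a₁} {f₁ : a₁ ⟶ a₂} {f₂ : a₂ ⟶ a₃} {f₃ : a₃ ⟶ a₄}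
    {g₀ : b₀ ⟶ b₁} {g₁ : b₁ ⟶ b₂} {g₂ : b₂ ⟶ b₃} {g₃ : b₃ ⟶ b₄}
    (h₀ : u₀ ≫ g₀ = f₀ ≫ u₁) (h₁ : u₁ ≫ g₁ = f₁ ≫ u₂) (h₂ : u₂ ≫ g₂ = f₂ ≫ u₃)
    (h₃ : u₃ ≫ g₃ = f₃ ≫ u₄) :
    u₀ ≫ g₀ ≫ g₁ ≫ g₂ ≫ g₃ = (f₀ ≫ f₁ ≫ f₂ ≫ f₃) ≫ u₄ := by
  simp only [Category.assoc]
  rw [reassoc_of% h₀, reassoc_of% h₁, reassoc_of% h₂, h₃]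

variable [HasInjectiveResolutions A] (H : A ⥤ A) [H.Additive] [PreservesFiniteLimits H]
    [PreservesFiniteColimits H] [H.PreservesInjectiveObjects] (F : A ⥤ B) [F.Additive]
    (K : B ⥤ B) [K.Additive] [PreservesFiniteLimits K]
    [PreservesFiniteColimits K]

/-- If `F` intertwines exact functors `H` and `K`, where `H` preserves injectives, then so do
its right derived functors. -/
def rightDerivedIso (e : H ⋙ F ≅ F ⋙ K) (l : ℕ) :
    H ⋙ F.rightDerived l ≅ F.rightDerived l ⋙ K :=
  NatIso.ofComponents (fun X =>
    let I := (HasInjectiveResolution.out (Z := X)).some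
    (mapInjectiveResolution H I).isoRightDerivedObj F l ≪≫
      (HomologicalComplex.homologyFunctor B _ l).mapIso
        ((NatIso.mapHomologicalComplex e (ComplexShape.up ℕ)).app I.cocomplex) ≪≫
      (((F.mapHomologicalComplex _).obj I.cocomplex).sc l).mapHomologyIso K ≪≫
      K.mapIso (I.isoRightDerivedObj F l).symm) fun {X Y} f => by
    let I := (HasInjectiveResolution.out (Z := X)).some
    let J := (HasInjectiveResolution.out (Z := Y)).some
    let φ := InjectiveResolution.desc f J I
    have hφ : I.ι.f 0 ≫ φ.f 0 = f ≫ J.ι.f 0 := InjectiveResolution.desc_commutes_zero f J I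
    have hφ' : (mapInjectiveResolution H I).ι.f 0 ≫ H.map (φ.f 0) =
        H.map f ≫ (mapInjectiveResolution H J).ι.f 0 := by
      rw [mapInjectiveResolution_ι_f_zero, mapInjectiveResolution_ι_f_zero]
      exact (H.map_comp _ _).symm.trans ((congrArg H.map hφ).trans (H.map_comp _ _))
    have h1 := InjectiveResolution.isoRightDerivedObj_hom_naturality (H.map f)
      (mapInjectiveResolution H I) (mapInjectiveResolution H J) ((H.mapHomologicalComplex _).map φ)
      hφ' F l
    have h2 := InjectiveResolution.isoRightDerivedObj_inv_naturality f I J φ hφ F l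
    have h3 := (NatTrans.mapHomologicalComplex e.hom (ComplexShape.up ℕ)).naturality φ
    have h3' := (HomologicalComplex.homologyMap_comp _ _ l).symm.trans
      ((congrArg (HomologicalComplex.homologyMap · l) h3).trans
        (HomologicalComplex.homologyMap_comp _ _ l))
    have h4 := ShortComplex.mapHomologyIso_hom_naturality
      ((HomologicalComplex.shortComplexFunctor B (ComplexShape.up ℕ) l).map
        ((F.mapHomologicalComplex _).map φ)) K
    have h2' := (K.map_comp _ _).symm.trans ((congrArg K.map h2).trans (K.map_comp _ _))
    exact paste_four h1 h3' h4 h2'.symm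

end rightDerived
end MultiGraded

namespace MultiGraded

open DerivedCategory DerivedCategory.TStructure Functor

/-! ### Total right derived functors and exact functors -/

section mapPlus

variable {A B : Type*} [Category* A] [Category* B] [Abelian A] [Abelian B]
  [HasDerivedCategory A] [HasDerivedCategory B]

/-- The extension `D^+(A) ⥤ D^+(B)` of an exact functor. -/
def mapPlus (H : A ⥤ B) [H.Additive] [PreservesFiniteLimits H] [PreservesFiniteColimits H] :
    Plus A ⥤ Plus B :=
  t.plus.lift (Plus.ι ⋙ H.mapDerivedCategory) <| by
    rintro ⟨X, a, K, e, hK⟩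
    exact ⟨a, (H.mapHomologicalComplex _).obj K,
      H.mapDerivedCategory.mapIso e ≪≫ H.mapDerivedCategoryFactors.app K, inferInstance⟩

/-- The compatibility of `mapPlus` with the localization functors. -/
def mapPlusFac (H : A ⥤ B) [H.Additive] [PreservesFiniteLimits H] [PreservesFiniteColimits H] :
    Plus.Qh ⋙ mapPlus H ≅ H.mapHomotopyCategoryPlus ⋙ Plus.Qh :=
  (t.plus.fullyFaithfulι.whiskeringRight _).preimageIso
    (isoWhiskerLeft (HomotopyCategory.Plus.ι A) H.mapDerivedCategoryFactorsh)

variable [EnoughInjectives A] (H : A ⥤ A) [H.Additive] [PreservesFiniteLimits H]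
  [PreservesFiniteColimits H] [H.PreservesInjectiveObjects] (F : A ⥤ B) [F.Additive]
  (K : B ⥤ B) [K.Additive] [PreservesFiniteLimits K] [PreservesFiniteColimits K]

/-- The natural transformation exhibiting `mapPlus H ⋙ RF` as a right derived functor. -/
def unitLeft : H.mapHomotopyCategoryPlus ⋙ F.mapHomotopyCategoryPlus ⋙ Plus.Qh ⟶
    Plus.Qh ⋙ mapPlus H ⋙ F.rightDerivedFunctorPlus :=
  whiskerLeft H.mapHomotopyCategoryPlus F.rightDerivedFunctorPlusUnit ≫
    (Functor.associator _ _ _).inv ≫ whiskerRight (mapPlusFac H).inv F.rightDerivedFunctorPlus ≫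
    (Functor.associator _ _ _).hom

/-- The natural transformation exhibiting `RF ⋙ mapPlus K` as a right derived functor. -/
def unitRight : F.mapHomotopyCategoryPlus ⋙ K.mapHomotopyCategoryPlus ⋙ Plus.Qh ⟶
    Plus.Qh ⋙ F.rightDerivedFunctorPlus ⋙ mapPlus K :=
  whiskerLeft F.mapHomotopyCategoryPlus (mapPlusFac K).inv ≫
    (Functor.associator _ _ _).inv ≫ whiskerRight F.rightDerivedFunctorPlusUnit (mapPlus K) ≫
    (Functor.associator _ _ _).hom

instance : (mapPlus H ⋙ F.rightDerivedFunctorPlus).IsRightDerivedFunctor (unitLeft H F)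
    (HomotopyCategory.Plus.quasiIso A) :=
  (HomotopyCategory.Plus.localizerMorphism_derives _).isRightDerivedFunctor_of_isIso _ fun X => by
    -- The unit of `RF` is invertible at `H X`, because `H X` is a complex of injectives.
    have (m : ℤ) : Injective ((H.mapHomotopyCategoryPlus.obj
        ((HomotopyCategory.Plus.localizerMorphism A).functor.obj X)).obj.as.X m) :=
      H.injective_obj_of_injective (inferInstanceAs (Injective
        (((InjectiveObject.ι A).mapHomotopyCategoryPlus.obj X).obj.as.X m)))
    have : IsIso (F.rightDerivedFunctorPlusUnit.app (H.mapHomotopyCategoryPlus.obj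
        ((HomotopyCategory.Plus.localizerMorphism A).functor.obj X))) := inferInstance
    simp only [unitLeft, NatTrans.comp_app, whiskerLeft_app, whiskerRight_app]
    infer_instance

instance : (F.rightDerivedFunctorPlus ⋙ mapPlus K).IsRightDerivedFunctor (unitRight F K)
    (HomotopyCategory.Plus.quasiIso A) :=
  (HomotopyCategory.Plus.localizerMorphism_derives _).isRightDerivedFunctor_of_isIso _ fun X => by
    simp only [unitRight, NatTrans.comp_app, whiskerLeft_app, whiskerRight_app]
    infer_instance

/-- If `F` intertwines exact functors `H` and `K`, where `H` preserves injectives, then so does its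
total right derived functor. -/
def rightDerivedPlusIso (e : H ⋙ F ≅ F ⋙ K) :
    mapPlus H ⋙ F.rightDerivedFunctorPlus ≅ F.rightDerivedFunctorPlus ⋙ mapPlus K :=
  rightDerivedNatIso _ _ (unitLeft H F) (unitRight F K) (HomotopyCategory.Plus.quasiIso A)
    ((Functor.associator _ _ _).symm ≪≫ isoWhiskerRight (mapHomotopyCategoryPlusCompIso e ≪≫
      (mapHomotopyCategoryPlusCompIso (Iso.refl (F ⋙ K))).symm) Plus.Qh ≪≫ Functor.associator _ _ _)

end mapPlus

/-! ### Exact functors and opposite derived categories -/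

section opposite

variable {C : Type u} [Category.{v} C] [Abelian C] [HasDerivedCategory.{w} C]
  [HasDerivedCategory.{w} Cᵒᵖ]
  (G : C ⥤ C) [G.Additive] [PreservesFiniteLimits G] [PreservesFiniteColimits G]

/-- Passing to the opposite category commutes with termwise application of a functor. -/
def opEquivalenceMap : (G.mapHomologicalComplex (ComplexShape.up ℤ)).op ⋙
      (CochainComplex.opEquivalence C).functor ≅
    (CochainComplex.opEquivalence C).functor ⋙ G.op.mapHomologicalComplex (ComplexShape.up ℤ) :=
  NatIso.ofComponents (fun K => HomologicalComplex.Hom.isoOfComponents (fun _ => Iso.refl _)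
    (fun i j _ => (Category.id_comp _).trans (Category.comp_id _).symm))
    fun f => by
      ext i
      exact (Category.comp_id _).trans (Category.id_comp _).symm

instance : PreservesFiniteLimits G.op := preservesFiniteLimits_op G

instance : PreservesFiniteColimits G.op := preservesFiniteColimits_op G

instance : G.op.Additive where
  map_add := congrArg Quiver.Hom.op (G.map_add)

/-- Passing to the opposite category commutes with the derived extension of an exact functor. -/
def opToDerivedOpMap : G.mapDerivedCategory.op ⋙ opToDerivedOp C ≅
    opToDerivedOp C ⋙ G.op.mapDerivedCategory :=
  letI e : Q.op ⋙ G.mapDerivedCategory.op ⋙ opToDerivedOp C ≅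
      Q.op ⋙ opToDerivedOp C ⋙ G.op.mapDerivedCategory :=
    isoWhiskerRight (NatIso.op G.mapDerivedCategoryFactors.symm) (opToDerivedOp C) ≪≫
    isoWhiskerLeft (G.mapHomologicalComplex (ComplexShape.up ℤ)).op (opToDerivedOpFac C) ≪≫
    isoWhiskerRight (opEquivalenceMap G) Q ≪≫
    isoWhiskerLeft (CochainComplex.opEquivalence C).functor G.op.mapDerivedCategoryFactors.symm ≪≫
    isoWhiskerRight (opToDerivedOpFac C).symm G.op.mapDerivedCategory
  Localization.liftNatIso Q.op (HomologicalComplex.quasiIso C (ComplexShape.up ℤ)).op _ _ _ _ e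

/-- The canonical functor `D^b(C)ᵒᵖ ⥤ D^+(Cᵒᵖ)` commutes with the extensions of an exact functor. -/
def boundedOpToPlusMap :
    (mapBounded G).op ⋙ boundedOpToPlus C ≅ boundedOpToPlus C ⋙ mapPlus G.op :=
  (t.plus.fullyFaithfulι.whiskeringRight _).preimageIso
    (isoWhiskerLeft Bounded.ι.op (opToDerivedOpMap G))

instance [G.PreservesProjectiveObjects] : G.op.PreservesInjectiveObjects where
  injective_obj {X} hX := by
    have : Projective (G.obj X.unop) := inferInstance
    exact inferInstanceAs (Injective (op (G.obj X.unop)))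

variable [EnoughProjectives C] [G.PreservesProjectiveObjects]
  (F : Cᵒᵖ ⥤ C) [F.Additive] (K : C ⥤ C) [K.Additive] [PreservesFiniteLimits K]
  [PreservesFiniteColimits K]

/-- If a contravariant functor intertwines exact functors `G` and `K`, where `G` preserves
projectives, then so does its total right derived functor. -/
def rightDerivedContraIso (e : G.op ⋙ F ≅ F ⋙ K) :
    (mapBounded G).op ⋙ rightDerivedContra F ≅ rightDerivedContra F ⋙ mapPlus K :=
  isoWhiskerRight (boundedOpToPlusMap G) F.rightDerivedFunctorPlus ≪≫
    isoWhiskerLeft (boundedOpToPlus C) (rightDerivedPlusIso G.op F K e)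

end opposite

end MultiGraded

namespace MultiGraded

/-! ### Injective dimension of opposite categories, and cocycles -/

section dimension

/-- If `X` has projective dimension at most `d`, then `op X` has injective dimension at most `d`:
both are controlled by dimension shifting along `0 → K → P → X → 0` with `P` projective. -/
theorem hasInjectiveDimensionLT_op {C : Type*} [Category* C] [Abelian C] [EnoughProjectives C]
    (d : ℕ) (X : C) (h : HasProjectiveDimensionLT X (d + 1)) :
    HasInjectiveDimensionLT (op X) (d + 1) := by
  induction d generalizing X with
  | zero =>
    have : Projective X := projective_iff_hasProjectiveDimensionLT_one.2 h
    infer_instance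
  | succ d ih =>
    let S := ShortComplex.mk (kernel.ι (Projective.π X)) (Projective.π X) (by simp)
    have hS : S.ShortExact :=
      { exact := ShortComplex.exact_kernel _
        mono_f := inferInstanceAs (Mono (kernel.ι _))
        epi_g := inferInstanceAs (Epi (Projective.π X)) }
    have hP : HasProjectiveDimensionLT (Projective.over X) (d + 1) :=
      hasProjectiveDimensionLT_of_ge _ 1 _ (by lia)
    have hI : HasInjectiveDimensionLT (op (Projective.over X)) (d + 1 + 1) :=
      hasInjectiveDimensionLT_of_ge _ 1 _ (by lia)
    exact hS.op.hasInjectiveDimensionLT_X₁ (d + 1)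
      (ih _ (hS.hasProjectiveDimensionLT_X₁ (d + 1) hP h)) hI

variable {A : Type*} [Category* A] [Abelian A] (K : CochainComplex A ℤ)

theorem epi_toCycles (p : ℤ) (h : K.ExactAt (p + 1)) : Epi (K.toCycles p (p + 1)) := by
  refine Preadditive.epi_of_cancel_zero _ fun g hg => ?_
  obtain ⟨l, hl⟩ := CokernelCofork.IsColimit.desc' (K.homologyIsCokernel p (p + 1) (by simp)) g hg
  rw [← hl]
  have : l = 0 := (K.exactAt_iff_isZero_homology _ |>.1 h).eq_of_src _ _
  rw [this]
  exact comp_zero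

theorem shortExact_cycles (p : ℤ) (h : K.ExactAt (p + 1)) :
    (ShortComplex.mk (K.iCycles p) (K.toCycles p (p + 1)) (by
      rw [← cancel_mono (K.iCycles (p + 1))]; simp)).ShortExact where
  exact := ShortComplex.exact_of_f_is_kernel _ <|
    isKernelOfComp (K.iCycles (p + 1)) (K.d p (p + 1)) (K.cyclesIsKernel p (p + 1) (by simp)) _
      (by simp)
  mono_f := inferInstanceAs (Mono (K.iCycles p))
  epi_g := epi_toCycles K p h

/-- In a complex of injectives that is exact above degree `b`, the cocycles of degree `b + d` are
injective if all objects have injective dimension at most `d`: the exact sequences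
`0 → Zᵖ → Kᵖ → Zᵖ⁺¹ → 0` for `p ≥ b` lower the injective dimension by one in each degree. -/
theorem injective_cycles (d : ℕ) (hd : ∀ X : A, HasInjectiveDimensionLT X (d + 1))
    [∀ m, Injective (K.X m)] (b : ℤ) [K.IsLE b] : Injective (K.cycles (b + d)) := by
  have key : ∀ r e : ℕ, r + e = d → HasInjectiveDimensionLT (K.cycles (b + r)) (e + 1) := by
    intro r
    induction r with
    | zero =>
      rintro e rfl
      have := hd (K.cycles (b + (0 : ℕ)))
      rwa [Nat.zero_add] at this
    | succ r ih =>
      intro e he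
      have h1 := ih (e + 1) (by lia)
      have h2 : HasInjectiveDimensionLT (K.X (b + r)) (e + 1) :=
        hasInjectiveDimensionLT_of_ge _ 1 _ (by lia)
      have h3 := (shortExact_cycles K (b + r)
        (K.exactAt_of_isLE b _ (by lia))).hasInjectiveDimensionLT_X₃ (e + 1) h2 h1
      rwa [Nat.cast_succ, ← add_assoc]
  exact injective_iff_hasInjectiveDimensionLT_one.2 (key d 0 (by lia))

end dimension

open DerivedCategory DerivedCategory.TStructure

/-! ### Boundedness of total derived functors -/

section bounded

variable {A B : Type*} [Category* A] [Category* B] [Abelian A] [Abelian B]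
  [HasDerivedCategory A] [HasDerivedCategory B] [EnoughInjectives A] (F : A ⥤ B) [F.Additive]

/-- The right derived functor of `F`, evaluated at a bounded below complex of injectives. -/
def rightDerivedObjIso (K : CochainComplex.Plus A) [∀ m, Injective (K.obj.X m)] :
    (F.rightDerivedFunctorPlus.obj (Plus.Q.obj K)).obj ≅
      DerivedCategory.Q.obj ((F.mapHomologicalComplex (ComplexShape.up ℤ)).obj K.obj) :=
  Plus.ι.mapIso (asIso (F.rightDerivedFunctorPlusUnit.app
    ((HomotopyCategory.Plus.quotient A).obj K))).symm ≪≫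
    (quotientCompQhIso B).app ((F.mapHomologicalComplex (ComplexShape.up ℤ)).obj K.obj)

/-- In the derived category, a complex with no cohomology in degrees `> m` is isomorphic to its
truncation. -/
def truncLEIso (L : CochainComplex A ℤ) (m : ℤ) [hL : L.IsLE m] :
    DerivedCategory.Q.obj (L.truncLE m) ≅ DerivedCategory.Q.obj L :=
  have : QuasiIso (L.ιTruncLE m) := (L.quasiIso_ιTruncLE_iff m).2 hL
  asIso (DerivedCategory.Q.map (L.ιTruncLE m))

/-- Every object of `D^+(A)` with cohomology in degrees `≤ b` is represented by a complex of
injectives that vanishes in degrees `> b + d`, if `A` has injective dimension `≤ d`. -/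
theorem exists_injective_isStrictlyLE (d : ℕ) (hd : ∀ X : A, HasInjectiveDimensionLT X (d + 1))
    (X : Plus A) (b : ℤ) [X.obj.IsLE b] :
    ∃ K : CochainComplex.Plus A, (∀ m, Injective (K.obj.X m)) ∧ K.obj.IsStrictlyLE (b + d) ∧
      Nonempty (Plus.Q.obj K ≅ X) := by
  obtain ⟨a, ha⟩ := X.property
  have : X.IsGE a := (X.isGE_ι_obj_iff a).1 ha
  obtain ⟨L, hL, ⟨e⟩⟩ := DerivedCategory.Plus.exists_injective_nonempty_iso X a
  let L' : CochainComplex A ℤ := ((InjectiveObject.ι A).mapCochainComplexPlus.obj L).obj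
  have hL' : L'.IsStrictlyGE a :=
    inferInstanceAs (CochainComplex.IsStrictlyGE
      (((InjectiveObject.ι A).mapHomologicalComplex _).obj L.obj) a)
  have hinj (m : ℤ) : Injective (L'.X m) :=
    inferInstanceAs (Injective ((InjectiveObject.ι A).obj (L.obj.X m)))
  have e' : DerivedCategory.Q.obj L' ≅ X.obj := Plus.ι.mapIso e
  have hLE : L'.IsLE b := by
    rw [← isLE_Q_obj_iff]
    exact t.isLE_of_iso e'.symm b
  have hLE' : L'.IsLE (b + d) := L'.isLE_of_le b _ (by lia)
  -- The truncation of `L'` has the cocycles of `L'` in its last degree `b + d`.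
  let K : CochainComplex.Plus A := ⟨L'.truncLE (b + d), a, inferInstance⟩
  refine ⟨K, fun m => ?_,
    inferInstanceAs ((L'.truncLE (b + d)).IsStrictlyLE (b + d)), ⟨Plus.ι.preimageIso
    (truncLEIso L' (b + d) ≪≫ e')⟩⟩
  · rcases lt_trichotomy m (b + d) with h | rfl | h
    · exact Injective.of_iso (L'.truncLEXIso (b + d) m h).symm (hinj m)
    · exact Injective.of_iso (L'.truncLEXIsoCycles (b + d)).symm (injective_cycles L' d hd b)
    · exact ((L'.truncLE (b + d)).isZero_of_isStrictlyLE (b + d) m h).injective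

/-- If `A` has injective dimension at most `d`, right derived functors raise the cohomological
degree of an object of `D^+(A)` by at most `d`. -/
theorem rightDerivedFunctorPlus_isLE (d : ℕ) (hd : ∀ X : A, HasInjectiveDimensionLT X (d + 1))
    (X : Plus A) (b : ℤ) [X.obj.IsLE b] : (F.rightDerivedFunctorPlus.obj X).obj.IsLE (b + d) := by
  obtain ⟨K, hK, hK', ⟨e⟩⟩ := exists_injective_isStrictlyLE d hd X b
  exact ⟨_, (Plus.ι.mapIso (F.rightDerivedFunctorPlus.mapIso e)).symm ≪≫ rightDerivedObjIso F K,
    inferInstance⟩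

variable {C : Type u} [Category.{v} C] [Abelian C] [EnoughProjectives C]
  [HasDerivedCategory.{w} C] [HasDerivedCategory.{w} Cᵒᵖ] (F : Cᵒᵖ ⥤ C) [F.Additive]

theorem rightDerivedContra_bounded (d : ℕ) (hd : ∀ X : C, HasProjectiveDimensionLT X (d + 1))
    (X : (Bounded C)ᵒᵖ) : t.bounded ((rightDerivedContra F).obj X).obj := by
  refine ⟨((rightDerivedContra F).obj X).property, ?_⟩
  obtain ⟨a, K, e, hK⟩ := X.unop.property.1
  have : ((boundedOpToPlus C).obj X).obj.IsLE (-a) := by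
    refine ⟨(CochainComplex.opEquivalence C).functor.obj (op K),
      (opToDerivedOp C).mapIso e.symm.op ≪≫ (opToDerivedOpFac C).app (op K), ?_⟩
    rw [CochainComplex.isStrictlyLE_iff]
    intro m hm
    exact (K.isZero_of_isStrictlyGE a (-m) (by lia)).op
  exact ⟨_, (rightDerivedFunctorPlus_isLE F d
    (fun Y => hasInjectiveDimensionLT_op d Y.unop (hd _)) ((boundedOpToPlus C).obj X) (-a))⟩

/-- The functor `RF : D^b(C)ᵒᵖ ⥤ D^b(C)`, when `C` has finite projective dimension. -/
def rightDerivedContraBounded (d : ℕ) (hd : ∀ X : C, HasProjectiveDimensionLT X (d + 1)) :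
    (Bounded C)ᵒᵖ ⥤ Bounded C :=
  t.bounded.lift (rightDerivedContra F ⋙ Plus.ι) (rightDerivedContra_bounded F d hd)

/-- The comparison of `rightDerivedContraBounded` with the functor to `D^+(C)`. -/
def rightDerivedContraBoundedIso (d : ℕ) (hd : ∀ X : C, HasProjectiveDimensionLT X (d + 1)) :
    rightDerivedContraBounded F d hd ⋙ boundedToPlus C ≅ rightDerivedContra F :=
  (t.plus.fullyFaithfulι.whiskeringRight _).preimageIso (Iso.refl (rightDerivedContra F ⋙ Plus.ι))

/-- If `F` intertwines exact functors `G` and `K`, where `G` preserves projectives, then so does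
`RF` on the bounded derived category. -/
def rightDerivedContraBoundedMap (d : ℕ) (hd : ∀ X : C, HasProjectiveDimensionLT X (d + 1))
    (G K : C ⥤ C) [G.Additive] [PreservesFiniteLimits G] [PreservesFiniteColimits G] [K.Additive]
    [PreservesFiniteLimits K] [PreservesFiniteColimits K] [G.PreservesProjectiveObjects]
    (e : G.op ⋙ F ≅ F ⋙ K) :
    (mapBounded G).op ⋙ rightDerivedContraBounded F d hd ≅
      rightDerivedContraBounded F d hd ⋙ mapBounded K :=
  (t.bounded.fullyFaithfulι.whiskeringRight _).preimageIso
    (Functor.isoWhiskerRight (rightDerivedContraIso G F K e) Plus.ι)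

end bounded

end MultiGraded

end

theorem theorem2p5 {k : Type u} [Field k] {n : ℕ} (i : Fin n) (j : ℤ) :
    -- `RHom_S(-, S)` restricts to a functor `𝔻 : D^b → (D^b)ᵒᵖ`, with the stated isomorphisms.
    (∃ 𝔻 : (DerivedCategory.Bounded (GrMod n k))ᵒᵖ ⥤ DerivedCategory.Bounded (GrMod n k),
      Nonempty (𝔻 ⋙ MultiGraded.boundedToPlus (GrMod n k) ≅ GrMod.RHomRing n k) ∧
      Nonempty ((MultiGraded.mapBounded (GrMod.slideLeft k i j)).op ⋙ 𝔻 ≅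
        𝔻 ⋙ MultiGraded.mapBounded (GrMod.slideRight k i (-j))) ∧
      Nonempty ((MultiGraded.mapBounded (GrMod.slideRight k i j)).op ⋙ 𝔻 ≅
        𝔻 ⋙ MultiGraded.mapBounded (GrMod.slideLeft k i (-j)))) ∧
    -- The isomorphisms of `Ext^l_S(-, S)`, natural in the module.
    ∀ l : ℕ,
      Nonempty ((GrMod.slideLeft k i j).op ⋙ GrMod.extRing n k l ≅
        GrMod.extRing n k l ⋙ GrMod.slideRight k i (-j)) ∧
      Nonempty ((GrMod.slideRight k i j).op ⋙ GrMod.extRing n k l ≅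
        GrMod.extRing n k l ⋙ GrMod.slideLeft k i (-j)) := by
  let eL := GrMod.dualPullIso (k := k) (MultiGraded.gc_tau_sigma i j)
    (MultiGraded.gc_rho_lam i (-j)) (GrMod.lam_dual_tau i j)
  let eR := GrMod.dualPullIso (k := k) (MultiGraded.gc_rho_lam i j)
    (MultiGraded.gc_tau_sigma i (-j)) (GrMod.sigma_dual_rho i j)
  refine ⟨⟨MultiGraded.rightDerivedContraBounded (GrMod.homFunctor (GrMod.ring n k)) n
      GrMod.hasProjectiveDimensionLT, ⟨MultiGraded.rightDerivedContraBoundedIso _ _ _⟩,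
      ⟨MultiGraded.rightDerivedContraBoundedMap _ _ _ _ _ eL⟩,
      ⟨MultiGraded.rightDerivedContraBoundedMap _ _ _ _ _ eR⟩⟩, fun l => ⟨?_, ?_⟩⟩
  · exact ⟨MultiGraded.rightDerivedIso _ _ _ eL l⟩
  · exact ⟨MultiGraded.rightDerivedIso _ _ _ eR l⟩
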